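/- **Setting.** Let $f=\frac1n\sum_{i=1}^n f_i$ with $f_i:\mathbb R^{d_1}\times\mathbb R^{d_2}\to\mathbb R$, $n\ge 1$, and let $\Phi(x)=\max_y f(x,y)$. Assume: 1. every $f_i$ is differentiable and $\nabla f_i$ is $L_f$-Lipschitz ($L_f>0$); 2. client $i$ has a stochastic gradient oracle $\nabla f_i(x,y;\xi)$, $\xi\sim\mathcal D_i$, with mean $\nabla f_i(x,y)$ and variance at most $\sigma^2$ at every $(x,y)$; 3. $\frac1n\sum_i\|\nabla_x f_i-\nabla_x f\|^2\le\varsigma_x^2$ and $\frac1n\sum_i\|\nabla_y f_i-\nabla_y f\|^2\le\varsigma_y^2$ at every $(x,y)$; 4. either (NC-PL) for every $x$, $\max_{y'}f(x,y')$ is attained and $\|\nabla_y f(x,y)\|^2\ge 2\mu\,(\max_{y'}f(x,y')-f(x,y))$ for all $y$, or (NC-SC) $f(x,\cdot)$ is $\mu$-strongly concave for every $x$; here $0<\mu\le L_f$, and $\kappa=L_f/\mu\ge 1$; 5. $\Phi(x_0)-\inf_x\Phi(x)\le\Delta$ and $\Phi(x_0)-f(x_0,y_0)\le D$. **Algorithm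 (Local SGDA).** All clients start at $(x_0,y_0)$. For $t=0,\dots,T-1$, every client $i$ computes one stochastic gradient at $(x^i_t,y^i_t)$ with a fresh independent sample $\xi^i_t\sim\mathcal D_i$ and sets $x^i_{t+1}=x^i_t-\eta_x\nabla_x f_i(x^i_t,y^i_t;\xi^i_t)$, $y^i_{t+1}=y^i_t+\eta_y\nabla_y f_i(x^i_t,y^i_t;\xi^i_t)$; if $\tau$ divides $t+1$, the clients communicate and all local models are replaced by their average. The output $\bar x_T$ is drawn uniformly from $\{x_t\}_{t=1}^T$, independently of the samples, where $x_t=\frac1n\sum_i x^i_t$. The step sizes are $\eta_y=\sqrt{n/(L_fT)}$ and $\eta_x=\frac{1}{8\kappa^2}\sqrt{n/(L_fT)}$. **Claim.** For all $0<a\le b$ there are positive constants $C_0,C_1,C_2,C_3$ depending only on $L_f,\sigma,\varsigma_x,\varsigma_y,\Delta,D,a,b$ (not on $n,\mu,\kappa,\varepsilon,T,d_1,d_2$ or the problem) such that $\Phi$ is differentiable and, for every $\varepsilon>0$, every $T\ge C_0n^3$ and every integer $\tau\ge1$ with $a\,T^{1/4}/n^{3/4}\le\tau\le b\,T^{1/4}/n^{3/4}$: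 * $\eta_y\le\frac{1}{8L_f\tau}$; * if $T\ge C_1\kappa^4/(n\varepsilon^4)$, then $\mathbb E\|\nabla\Phi(\bar x_T)\|\le\varepsilon$; * if $T=\lceil C_1\kappa^4/(n\varepsilon^4)\rceil$, then every client computes at most $C_2\,\kappa^4/(n\varepsilon^4)$ stochastic gradients (linear speedup in $n$), and the number of communication rounds, as well as $\lceil T/\tau\rceil$, is at most $C_3\,\kappa^3/\varepsilon^3$. -/

import Mathlib

open MeasureTheory ProbabilityTheory
open scoped ENNReal

noncomputable section

namespace LocalSGDA

/-- `ℝ^d` with the Euclidean norm. -/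
abbrev Vec (d : ℕ) : Type := EuclideanSpace ℝ (Fin d)

/-- Pairs `(x, y) ∈ ℝ^{d₁} × ℝ^{d₂}` with the Euclidean norm `(‖x‖² + ‖y‖²)^{1/2}`. -/
abbrev Joint (d₁ d₂ : ℕ) : Type := WithLp 2 (Vec d₁ × Vec d₂)

/-- The pair `(x, y)`. -/
def pair {d₁ d₂ : ℕ} (x : Vec d₁) (y : Vec d₂) : Joint d₁ d₂ := WithLp.toLp 2 (x, y)

/-- The average `(1/n) ∑ᵢ vᵢ` over the `n` clients. -/
def mean {n : ℕ} {E : Type*} [AddCommGroup E] [Module ℝ E] (v : Fin n → E) : E :=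
  (n : ℝ)⁻¹ • ∑ i, v i

/-- The global objective `f = (1/n) ∑ᵢ fᵢ`. -/
def globalLoss {d₁ d₂ n : ℕ} (f : Fin n → Joint d₁ d₂ → ℝ) : Joint d₁ d₂ → ℝ :=
  fun z => mean fun i => f i z

/-- The `x`-block of the gradient. -/
def gradX {d₁ d₂ : ℕ} (F : Joint d₁ d₂ → ℝ) (z : Joint d₁ d₂) : Vec d₁ := (gradient F z).fst

/-- The `y`-block of the gradient. -/
def gradY {d₁ d₂ : ℕ} (F : Joint d₁ d₂ → ℝ) (z : Joint d₁ d₂) : Vec d₂ := (gradient F z).snd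

/-- The envelope `Φ(x) = sup_y F(x, y)`; it is only used where the supremum is attained. -/
def envelope {d₁ d₂ : ℕ} (F : Joint d₁ d₂ → ℝ) (x : Vec d₁) : ℝ := ⨆ y, F (pair x y)

/-! ### Assumptions on the objective and on the oracle -/

/-- Every local loss is differentiable with an `L`-Lipschitz gradient. -/
def Smooth {d₁ d₂ n : ℕ} (L : ℝ) (f : Fin n → Joint d₁ d₂ → ℝ) : Prop :=
  ∀ i, Differentiable ℝ (f i) ∧
    ∀ z z' : Joint d₁ d₂, ‖gradient (f i) z - gradient (f i) z'‖ ≤ L * ‖z - z'‖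

/-- `G i z ξ`, with `ξ ∼ 𝒟ᵢ`, is an unbiased stochastic gradient of `fᵢ` at `z`, with variance at
most `σ²`. -/
def UnbiasedBoundedVariance {d₁ d₂ n : ℕ} {Ξ : Fin n → Type*} [∀ i, MeasurableSpace (Ξ i)]
    (σ : ℝ) (f : Fin n → Joint d₁ d₂ → ℝ) (𝒟 : ∀ i, Measure (Ξ i))
    (G : ∀ i, Joint d₁ d₂ → Ξ i → Joint d₁ d₂) : Prop :=
  ∀ i, Measurable (fun p : Joint d₁ d₂ × Ξ i => G i p.1 p.2) ∧
    ∀ z, Integrable (G i z) (𝒟 i) ∧ ∫ ξ, G i z ξ ∂(𝒟 i) = gradient (f i) z ∧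
      Integrable (fun ξ => ‖G i z ξ - gradient (f i) z‖ ^ 2) (𝒟 i) ∧
      ∫ ξ, ‖G i z ξ - gradient (f i) z‖ ^ 2 ∂(𝒟 i) ≤ σ ^ 2

/-- The heterogeneity across the clients is at most `ςx²` in the `x`-gradients and at most `ςy²` in
the `y`-gradients, uniformly over all points. -/
def BoundedHeterogeneity {d₁ d₂ n : ℕ} (ςx ςy : ℝ) (f : Fin n → Joint d₁ d₂ → ℝ) : Prop :=
  ∀ z, (mean fun i => ‖gradX (f i) z - gradX (globalLoss f) z‖ ^ 2) ≤ ςx ^ 2 ∧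
    (mean fun i => ‖gradY (f i) z - gradY (globalLoss f) z‖ ^ 2) ≤ ςy ^ 2

/-- The Polyak–Łojasiewicz condition in `y`: for every `x` the maximum over `y` is attained, and
`‖∇_y F(x, y)‖² ≥ 2μ (max_{y'} F(x, y') - F(x, y))`. -/
def PLInY {d₁ d₂ : ℕ} (μ : ℝ) (F : Joint d₁ d₂ → ℝ) : Prop :=
  ∀ x, (∃ y', ∀ y, F (pair x y) ≤ F (pair x y')) ∧
    ∀ y, 2 * μ * (envelope F x - F (pair x y)) ≤ ‖gradY F (pair x y)‖ ^ 2

/-- `F(x, ·)` is `μ`-strongly concave for every `x`. -/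
def StronglyConcaveInY {d₁ d₂ : ℕ} (μ : ℝ) (F : Joint d₁ d₂ → ℝ) : Prop :=
  ∀ x, StrongConcaveOn Set.univ μ fun y => F (pair x y)

/-! ### The algorithm -/

/-- The state of a run: the local models `(xⁱ, yⁱ)`, the number of stochastic gradients that each
client has computed so far, and the number of times that the clients have communicated their local
models to the server. -/
structure State (d₁ d₂ n : ℕ) where
  model : Fin n → Joint d₁ d₂
  gradCount : Fin n → ℕ
  rounds : ℕ

/-- The local descent step in `x` and ascent step in `y`, along the stochastic gradient `g`. -/
def descentAscent {d₁ d₂ : ℕ} (ηx ηy : ℝ) (z g : Joint d₁ d₂) : Joint d₁ d₂ :=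
  pair (z.fst - ηx • g.fst) (z.snd + ηy • g.snd)

/-- Iteration `t` of Local SGDA: each client calls its oracle `g i` once, at its own model, and makes
a local step; if `t + 1` is a multiple of `τ`, the clients then communicate, and every local model is
replaced by the average. -/
def step {d₁ d₂ n : ℕ} (ηx ηy : ℝ) (τ : ℕ) (g : Fin n → Joint d₁ d₂ → Joint d₁ d₂) (t : ℕ)
    (s : State d₁ d₂ n) : State d₁ d₂ n :=
  let z : Fin n → Joint d₁ d₂ := fun i => descentAscent ηx ηy (s.model i) (g i (s.model i))
  if (t + 1) % τ = 0 then
    { model := fun _ => mean z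
      gradCount := fun i => s.gradCount i + 1
      rounds := s.rounds + 1 }
  else
    { model := z
      gradCount := fun i => s.gradCount i + 1
      rounds := s.rounds }

/-- The state of Local SGDA after `t` iterations, started at `z₀ = (x₀, y₀)` at every client, where
client `i` uses the data sample `ξ s i` in iteration `s`. -/
def run {d₁ d₂ n : ℕ} {Ξ : Fin n → Type*} (G : ∀ i, Joint d₁ d₂ → Ξ i → Joint d₁ d₂)
    (ηx ηy : ℝ) (τ : ℕ) (z₀ : Joint d₁ d₂) (ξ : ℕ → ∀ i, Ξ i) : ℕ → State d₁ d₂ n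
  | 0 => { model := fun _ => z₀, gradCount := fun _ => 0, rounds := 0 }
  | t + 1 => step ηx ηy τ (fun i z => G i z (ξ t i)) t (run G ηx ηy τ z₀ ξ t)

/-- The average iterate `x_t = (1/n) ∑ᵢ xᵢ_t`. -/
def avgX {d₁ d₂ n : ℕ} (s : State d₁ d₂ n) : Vec d₁ := mean fun i => (s.model i).fst

/-- The randomness of a run with `T` iterations: the samples `ξ t i ∼ 𝒟ᵢ` are independent over all
iterations `t` and clients `i`, and the output index `J` is uniform on `{1, …, T}` and independent of
the samples. -/
structure IsSampling {n : ℕ} {Ξ : Fin n → Type*} [∀ i, MeasurableSpace (Ξ i)] {Ω : Type*}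
    [MeasurableSpace Ω] (P : Measure Ω) (𝒟 : ∀ i, Measure (Ξ i)) (ξ : ℕ → ∀ i, Ω → Ξ i)
    (T : ℕ) (J : Ω → ℕ) : Prop where
  measurable_sample : ∀ t i, Measurable (ξ t i)
  law_sample : ∀ t i, P.map (ξ t i) = 𝒟 i
  indep_sample : iIndepFun (fun (p : ℕ × Fin n) => ξ p.1 p.2) P
  measurable_index : Measurable J
  uniform_index : ∀ t ∈ Finset.Icc 1 T, P {ω | J ω = t} = (T : ℝ≥0∞)⁻¹
  indep_index : IndepFun J (fun ω (p : ℕ × Fin n) => ξ p.1 p.2 ω) P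

/-- The random point `x` is `ε`-accurate for `Φ`: `𝔼 ‖∇Φ(x)‖ ≤ ε`. -/
def IsAccurate {d : ℕ} {Ω : Type*} [MeasurableSpace Ω] (P : Measure Ω) (Φ : Vec d → ℝ) (ε : ℝ)
    (x : Ω → Vec d) : Prop :=
  Integrable (fun ω => ‖gradient Φ (x ω)‖) P ∧ ∫ ω, ‖gradient Φ (x ω)‖ ∂P ≤ ε

/-- The step size in `y`, `√(n / (L T))`. -/
def stepY (L : ℝ) (n T : ℕ) : ℝ := √((n : ℝ) / (L * T))

/-- The step size in `x`, `(1 / (8 κ²)) √(n / (L T))`. -/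
def stepX (L κ : ℝ) (n T : ℕ) : ℝ := 1 / (8 * κ ^ 2) * √((n : ℝ) / (L * T))

/-- The order `T^{1/4} / n^{3/4}` of the number of local updates per communication round. -/
def tauScale (n T : ℕ) : ℝ := (T : ℝ) ^ (1 / 4 : ℝ) / (n : ℝ) ^ (3 / 4 : ℝ)

end LocalSGDA

end

/-! ### Quadratic bounds for functions with Lipschitz gradient, and the geometry of pairs. -/

namespace LocalSGDA

open scoped Gradient RealInnerProductSpace

/-! The argument follows the potential `2Φ(x) - f(x, y) = Φ(x) + (Φ(x) - f(x, y))` along the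
averaged model. It starts at most at `Φ(x₀) + D`, and it is never below `Φ(x) ≥ Φ(x₀) - Δ`.

The PL condition gives two facts about `Φ`. It has a quadratic upper model with constant `L + L²/μ`
around every point, with `∇Φ(x) = ∇ₓf(x, y')` at any maximizer `y'` (`envelope_add_le`,
`hasGradientAt_envelope`); and `‖∇Φ - ∇ₓf‖² ≤ 3κ²‖∇_y f‖²`. Strong concavity implies PL, so only PL
is treated. Put `a = ∇Φ` and `e = a - ∇ₓf`. The potential has `x`-gradient `a + e` while the step
goes along `a - e`, so `x` gains `‖a‖² - ‖e‖²`. With `ηx = ηy/(8κ²)` the loss `ηx‖e‖²` is absorbed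
by the `ηy‖∇_y f‖²` gained in `y` (`potential_descentAscent_le`).

Local steps and random samples disturb this in two ways. The noise is centred given the past and has
variance `σ²/n` after averaging, which is the source of the linear speedup. The drift costs `L²`
times the spread of the local models, which vanishes at each communication and grows by a factor at
most `1 + 2/τ` plus a constant per step; hence it stays `O(τ²ηy²)` in expectation
(`le_of_reset_recursion`).

Telescoping bounds the average of `𝔼‖∇Φ(x_t)‖²` by a constant times `κ² (1/(ηy T) + (τηy)² + ηy/n)`.
With `ηy ∼ √(n/T)` and `τ ∼ T^{1/4}/n^{3/4}` all three terms have order `1/√(nT)`, so `nT ∼ κ⁴/ε⁴`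
suffices, and the number of rounds `T/τ ∼ (nT)^{3/4}` is of order `κ³/ε³`, free of `n`. -/

theorem hasDerivAt_comp_line {E : Type*} [NormedAddCommGroup E] [InnerProductSpace ℝ E]
    [CompleteSpace E] {F : E → ℝ} (hF : Differentiable ℝ F) (z w : E) (s : ℝ) :
    HasDerivAt (fun s : ℝ => F (z + s • w)) ⟪∇ F (z + s • w), w⟫ s := by
  have h1 : HasDerivAt (fun s : ℝ => z + s • w) w s := by
    simpa using ((hasDerivAt_id s).smul_const w).const_add z
  have h2 := ((hF (z + s • w)).hasFDerivAt).comp_hasDerivAt s h1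
  rwa [← inner_gradient_left] at h2

/-- The quadratic approximation of a function with an `L`-Lipschitz gradient. -/
theorem abs_sub_linearization_le {E : Type*} [NormedAddCommGroup E] [InnerProductSpace ℝ E]
    [CompleteSpace E] {F : E → ℝ} {L : ℝ} (hF : Differentiable ℝ F)
    (hL : ∀ z z', ‖∇ F z - ∇ F z'‖ ≤ L * ‖z - z'‖) (z w : E) :
    |F (z + w) - F z - ⟪∇ F z, w⟫| ≤ L / 2 * ‖w‖ ^ 2 := by
  have hd : ∀ s : ℝ, HasDerivAt (fun s : ℝ => F (z + s • w) - F z - s * ⟪∇ F z, w⟫)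
      (⟪∇ F (z + s • w) - ∇ F z, w⟫) s := by
    intro s
    have h2 := hasDerivAt_comp_line hF z w s
    have h3 := (h2.sub_const (F z)).sub ((hasDerivAt_id s).mul_const ⟪∇ F z, w⟫)
    rw [inner_sub_left]
    simpa [Pi.sub_def] using h3
  have hB : ∀ s : ℝ, HasDerivAt (fun s : ℝ => L / 2 * ‖w‖ ^ 2 * s ^ 2) (L * ‖w‖ ^ 2 * s) s := by
    intro s
    have := (hasDerivAt_pow 2 s).const_mul (L / 2 * ‖w‖ ^ 2)
    refine this.congr_deriv ?_
    rw [show (2 - 1 : ℕ) = 1 from rfl, pow_one]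
    push_cast
    ring
  -- The remainder along the segment vanishes at `0` and its derivative is at most `L‖w‖²s`, so it
  -- is dominated by the primitive `B`.
  have := image_norm_le_of_norm_deriv_right_le_deriv_boundary (a := 0) (b := 1)
    (f := fun s : ℝ => F (z + s • w) - F z - s * ⟪∇ F z, w⟫)
    (f' := fun s => ⟪∇ F (z + s • w) - ∇ F z, w⟫)
    (B := fun s : ℝ => L / 2 * ‖w‖ ^ 2 * s ^ 2) (B' := fun s => L * ‖w‖ ^ 2 * s)
    (fun s _ => (hd s).continuousAt.continuousWithinAt) (fun s _ => (hd s).hasDerivWithinAt)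
    (by simp) hB (by
      intro s hs
      calc ‖⟪∇ F (z + s • w) - ∇ F z, w⟫‖ ≤ ‖∇ F (z + s • w) - ∇ F z‖ * ‖w‖ :=
            norm_inner_le_norm _ _
        _ ≤ (L * ‖z + s • w - z‖) * ‖w‖ := by gcongr; exact hL _ _
        _ = L * ‖w‖ ^ 2 * s := by
            rw [add_sub_cancel_left, norm_smul, Real.norm_of_nonneg hs.1]; ring)
    (x := 1) (by simp)
  simpa using this

/-- A quadratic lower bound `-⟪e, u⟫ ≤ δ + c / 2 * ‖u‖²` in all directions bounds `e`. -/
theorem norm_sq_le_of_forall_quadratic_nonneg {E : Type*} [NormedAddCommGroup E]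
    [InnerProductSpace ℝ E] {c δ : ℝ} (hc : 0 < c) (e : E)
    (h : ∀ u : E, 0 ≤ δ + ⟪e, u⟫ + c / 2 * ‖u‖ ^ 2) : ‖e‖ ^ 2 ≤ 2 * c * δ := by
  -- This direction minimizes the right-hand side.
  have := h (-c⁻¹ • e)
  rw [inner_smul_right, real_inner_self_eq_norm_sq, norm_smul, norm_neg, norm_inv,
    Real.norm_of_nonneg hc.le] at this
  have h2 : 0 ≤ 2 * c * (δ + -c⁻¹ * ‖e‖ ^ 2 + c / 2 * (c⁻¹ * ‖e‖) ^ 2) := by positivity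
  have h3 : 2 * c * (δ + -c⁻¹ * ‖e‖ ^ 2 + c / 2 * (c⁻¹ * ‖e‖) ^ 2) = 2 * c * δ - ‖e‖ ^ 2 := by
    field_simp; ring
  linarith

instance {E F : Type*} [NormedAddCommGroup E] [NormedSpace ℝ E] [NormedAddCommGroup F]
    [NormedSpace ℝ F] : ContinuousSMul ℝ (WithLp 2 (E × F)) := inferInstance

variable {d₁ d₂ : ℕ}

theorem pair_add (x u : Vec d₁) (y v : Vec d₂) : pair (x + u) (y + v) = pair x y + pair u v := rfl

theorem pair_fst_snd (z : Joint d₁ d₂) : pair z.fst z.snd = z := rfl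

@[simp] theorem pair_fst (x : Vec d₁) (y : Vec d₂) : (pair x y).fst = x := rfl

@[simp] theorem pair_snd (x : Vec d₁) (y : Vec d₂) : (pair x y).snd = y := rfl

theorem norm_sq_eq (z : Joint d₁ d₂) : ‖z‖ ^ 2 = ‖z.fst‖ ^ 2 + ‖z.snd‖ ^ 2 :=
  WithLp.prod_norm_sq_eq_of_L2 z

theorem inner_eq (z w : Joint d₁ d₂) : ⟪z, w⟫ = ⟪z.fst, w.fst⟫ + ⟪z.snd, w.snd⟫ :=
  WithLp.prod_inner_apply z w

theorem norm_snd_le (z : Joint d₁ d₂) : ‖z.snd‖ ≤ ‖z‖ := by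
  have := norm_sq_eq z
  exact le_of_sq_le_sq (by nlinarith [sq_nonneg ‖z.fst‖]) (norm_nonneg _)

theorem continuous_pair : Continuous fun p : Vec d₁ × Vec d₂ => pair p.1 p.2 :=
  WithLp.prod_continuous_toLp 2 _ _

/-! ### Differentiability and gradient of the envelope under the PL condition. -/

section Envelope

variable {F : Joint d₁ d₂ → ℝ} {L μ : ℝ}

theorem PLInY.le_envelope (h : PLInY μ F) (x : Vec d₁) (y : Vec d₂) :
    F (pair x y) ≤ envelope F x := by
  obtain ⟨y', hy'⟩ := (h x).1
  exact le_ciSup (f := fun y => F (pair x y)) ⟨F (pair x y'), by rintro _ ⟨y, rfl⟩; exact hy' y⟩ y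

theorem envelope_eq_of_isMax {x : Vec d₁} {y' : Vec d₂} (h : ∀ y, F (pair x y) ≤ F (pair x y')) :
    envelope F x = F (pair x y') :=
  le_antisymm (ciSup_le h)
    (le_ciSup (f := fun y => F (pair x y)) ⟨F (pair x y'), by rintro _ ⟨y, rfl⟩; exact h y⟩ y')

variable (hF : Differentiable ℝ F) (hL : ∀ z z', ‖∇ F z - ∇ F z'‖ ≤ L * ‖z - z'‖)
include hF hL

theorem gradY_eq_zero_of_isMax (hL0 : 0 < L) {x : Vec d₁} {y' : Vec d₂}
    (h : ∀ y, F (pair x y) ≤ F (pair x y')) : gradY F (pair x y') = 0 := by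
  have : ‖-gradY F (pair x y')‖ ^ 2 ≤ 2 * L * 0 := by
    refine norm_sq_le_of_forall_quadratic_nonneg hL0 _ fun v => ?_
    have h1 := (abs_le.1 (abs_sub_linearization_le hF hL (pair x y') (pair 0 v))).1
    rw [← pair_add, add_zero, norm_sq_eq, inner_eq] at h1
    simp only [pair_fst, pair_snd, inner_zero_right, norm_zero] at h1
    rw [inner_neg_left, gradY]
    have h2 := h (y' + v)
    norm_num at h1
    linarith
  rw [mul_zero, norm_neg] at this
  exact norm_eq_zero.1 (pow_eq_zero_iff (two_ne_zero) |>.1 (le_antisymm this (sq_nonneg _)))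

/-- The old maximizer `y'` stays a good competitor: `∇_y F` vanishes at `(x, y')`, so it is at most
`L‖u‖` at `(x + u, y')`, and PL turns this into a value gap of at most `L²‖u‖²/(2μ)`. No continuity
or uniqueness of maximizers is needed. -/
theorem envelope_add_le (hL0 : 0 < L) (hμ : 0 < μ) (hPL : PLInY μ F) {x : Vec d₁} {y' : Vec d₂}
    (h : ∀ y, F (pair x y) ≤ F (pair x y')) (u : Vec d₁) :
    envelope F (x + u) ≤
      envelope F x + ⟪gradX F (pair x y'), u⟫ + (L + L ^ 2 / μ) / 2 * ‖u‖ ^ 2 := by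
  have h1 := (abs_le.1 (abs_sub_linearization_le hF hL (pair x y') (pair u 0))).2
  have h2 := (hPL (x + u)).2 y'
  have h3 := hL (pair (x + u) y') (pair x y')
  have h4 : pair (x + u) y' = pair x y' + pair u 0 := by rw [← pair_add, add_zero]
  have h5 : ‖gradY F (pair (x + u) y')‖ ≤ L * ‖u‖ := by
    have h6 : gradY F (pair (x + u) y') = (∇ F (pair (x + u) y') - ∇ F (pair x y')).snd := by
      rw [WithLp.sub_snd]
      change _ = _ - gradY F (pair x y')
      rw [gradY_eq_zero_of_isMax hF hL hL0 h, sub_zero]; rfl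
    have h7 : ‖(pair u 0 : Joint d₁ d₂)‖ = ‖u‖ := by
      rw [← sq_eq_sq₀ (norm_nonneg _) (norm_nonneg _), norm_sq_eq]; simp
    rw [h6]
    refine (norm_snd_le _).trans (h3.trans ?_)
    rw [h4, add_sub_cancel_left, h7]
  rw [← h4, norm_sq_eq, inner_eq] at h1
  simp only [pair_fst, pair_snd, inner_zero_right, norm_zero] at h1
  have h8 : ‖gradY F (pair (x + u) y')‖ ^ 2 ≤ L ^ 2 * ‖u‖ ^ 2 := by
    rw [← mul_pow]; gcongr
  have h9 : envelope F (x + u) - F (pair (x + u) y') ≤ L ^ 2 * ‖u‖ ^ 2 / (2 * μ) := by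
    rw [le_div_iff₀ (by positivity)]; linarith
  have h10 : L ^ 2 * ‖u‖ ^ 2 / (2 * μ) = (L ^ 2 / μ) / 2 * ‖u‖ ^ 2 := by field_simp
  rw [envelope_eq_of_isMax h, gradX]
  norm_num at h1
  nlinarith

theorem le_envelope_add (hPL : PLInY μ F) {x : Vec d₁} {y' : Vec d₂}
    (h : ∀ y, F (pair x y) ≤ F (pair x y')) (u : Vec d₁) :
    envelope F x + ⟪gradX F (pair x y'), u⟫ - L / 2 * ‖u‖ ^ 2 ≤ envelope F (x + u) := by
  have h1 := (abs_le.1 (abs_sub_linearization_le hF hL (pair x y') (pair u 0))).1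
  have h2 := hPL.le_envelope (x + u) y'
  have h4 : pair (x + u) y' = pair x y' + pair u 0 := by rw [← pair_add, add_zero]
  rw [← h4, norm_sq_eq, inner_eq] at h1
  simp only [pair_fst, pair_snd, inner_zero_right, norm_zero] at h1
  rw [envelope_eq_of_isMax h, gradX]
  norm_num at h1
  linarith

/-- Danskin's theorem by a two-sided quadratic bound. Any maximizer serves, so none has to be
selected. -/
theorem hasGradientAt_envelope (hL0 : 0 < L) (hμ : 0 < μ) (hPL : PLInY μ F) {x : Vec d₁}
    {y' : Vec d₂} (h : ∀ y, F (pair x y) ≤ F (pair x y')) :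
    HasGradientAt (envelope F) (gradX F (pair x y')) x := by
  rw [hasGradientAt_iff_isLittleO_nhds_zero]
  have : (fun u : Vec d₁ => envelope F (x + u) - envelope F x - ⟪gradX F (pair x y'), u⟫)
      =O[nhds 0] fun u => ‖u‖ ^ 2 := by
    refine Asymptotics.IsBigO.of_bound ((L + L ^ 2 / μ) / 2) (Filter.Eventually.of_forall ?_)
    intro u
    have h1 := envelope_add_le hF hL hL0 hμ hPL h u
    have h2 := le_envelope_add hF hL hPL h u
    have h3 : 0 ≤ (L ^ 2 / μ) / 2 * ‖u‖ ^ 2 := by positivity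
    rw [Real.norm_eq_abs, norm_pow, norm_norm, abs_le]
    constructor <;> nlinarith
  refine this.trans_isLittleO ?_
  exact Asymptotics.isLittleO_norm_pow_id one_lt_two

theorem differentiable_envelope (hL0 : 0 < L) (hμ : 0 < μ) (hPL : PLInY μ F) :
    Differentiable ℝ (envelope F) := fun x =>
  let ⟨_, h⟩ := (hPL x).1
  (hasGradientAt_envelope hF hL hL0 hμ hPL h).differentiableAt

theorem envelope_add_le_gradient (hL0 : 0 < L) (hμ : 0 < μ) (hPL : PLInY μ F) (x u : Vec d₁) :
    envelope F (x + u) ≤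
      envelope F x + ⟪∇ (envelope F) x, u⟫ + (L + L ^ 2 / μ) / 2 * ‖u‖ ^ 2 := by
  obtain ⟨y', h⟩ := (hPL x).1
  rw [(hasGradientAt_envelope hF hL hL0 hμ hPL h).gradient]
  exact envelope_add_le hF hL hL0 hμ hPL h u

/-- The `x`-gradients of `F` and of its envelope differ by at most `√3 κ ‖∇_y F‖`. -/
theorem norm_gradient_envelope_sub_gradX_sq_le (hμ : 0 < μ) (hμL : μ ≤ L)
    (hPL : PLInY μ F) (x : Vec d₁) (y : Vec d₂) :
    ‖∇ (envelope F) x - gradX F (pair x y)‖ ^ 2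
      ≤ 3 * (L / μ) ^ 2 * ‖gradY F (pair x y)‖ ^ 2 := by
  have hL0 : 0 < L := hμ.trans_le hμL
  -- For fixed `y` the gap `Φ - F(·, y)` is nonnegative and has a quadratic upper model with
  -- constant `(L + L²/μ) + L`; its squared slope is therefore at most twice this constant times its
  -- value. PL then bounds the value by `‖∇_y F‖²`.
  have h1 : ‖∇ (envelope F) x - gradX F (pair x y)‖ ^ 2
      ≤ 2 * (2 * L + L ^ 2 / μ) * (envelope F x - F (pair x y)) := by
    refine norm_sq_le_of_forall_quadratic_nonneg (by positivity) _ fun u => ?_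
    have h1 := (abs_le.1 (abs_sub_linearization_le hF hL (pair x y) (pair u 0))).1
    have h2 := hPL.le_envelope (x + u) y
    have h3 := envelope_add_le_gradient hF hL hL0 hμ hPL x u
    have h4 : pair (x + u) y = pair x y + pair u 0 := by rw [← pair_add, add_zero]
    rw [← h4, norm_sq_eq, inner_eq] at h1
    simp only [pair_fst, pair_snd, inner_zero_right, norm_zero] at h1
    rw [inner_sub_left, gradX]
    norm_num at h1
    linarith
  have h2 := (hPL x).2 y
  have hκ : 1 ≤ L / μ := (one_le_div hμ).2 hμL
  have h3 : 2 * L + L ^ 2 / μ ≤ 3 * (L / μ) ^ 2 * μ := by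
    have e1 : L = L / μ * μ := by field_simp
    have e2 : L ^ 2 / μ = (L / μ) ^ 2 * μ := by field_simp
    rw [e2]
    nlinarith [mul_le_mul_of_nonneg_right hκ (by positivity : 0 ≤ L / μ * μ)]
  have h4 : 0 ≤ envelope F x - F (pair x y) := sub_nonneg.2 (hPL.le_envelope x y)
  calc _ ≤ _ := h1
    _ ≤ 2 * (3 * (L / μ) ^ 2 * μ) * (envelope F x - F (pair x y)) := by gcongr
    _ = 3 * (L / μ) ^ 2 * (2 * μ * (envelope F x - F (pair x y))) := by ring
    _ ≤ _ := by gcongr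

end Envelope

/-! ### Reduction of strong concavity to the PL condition. -/

section StrongConcavity

/-- The first-order upper bound of a strongly concave function along a line. -/
theorem _root_.StrongConcaveOn.le_linearization {E : Type*} [NormedAddCommGroup E]
    [NormedSpace ℝ E] {φ : E → ℝ} {μ : ℝ} (h : StrongConcaveOn Set.univ μ φ) {y v : E} {φ' : ℝ}
    (h1 : HasDerivAt (fun s : ℝ => φ (y + s • v)) φ' 0) :
    φ (y + v) ≤ φ y + φ' - μ / 2 * ‖v‖ ^ 2 := by
  have h2 := h1.tendsto_slope_zero_right
  have h3 : Filter.Tendsto (fun s : ℝ => φ (y + v) - φ y + (1 - s) * (μ / 2 * ‖v‖ ^ 2))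
      (nhdsWithin 0 (Set.Ioi 0)) (nhds (φ (y + v) - φ y + (1 - 0) * (μ / 2 * ‖v‖ ^ 2))) := by
    refine Filter.Tendsto.mono_left (Continuous.tendsto ?_ _) nhdsWithin_le_nhds
    fun_prop
  -- The chord inequality between `y` and `y + v`, divided by `s`, is passed to the limit `s → 0⁺`.
  have h4 := le_of_tendsto_of_tendsto h3 h2 (by
    filter_upwards [Ioo_mem_nhdsGT (zero_lt_one' ℝ)] with s hs
    change s ∈ Set.Ioo (0 : ℝ) 1 at hs
    obtain ⟨-, h'⟩ := h
    have h5 := h' (Set.mem_univ y) (Set.mem_univ (y + v)) (show 0 ≤ 1 - s by linarith [hs.2])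
      hs.1.le (by ring)
    have h6 : (1 - s) • y + s • (y + v) = y + s • v := by module
    rw [h6] at h5
    simp only [smul_eq_mul, sub_add_cancel_left, norm_neg] at h5
    simp only [zero_add, zero_smul, add_zero, smul_eq_mul]
    rw [inv_mul_eq_div, le_div_iff₀ hs.1]
    nlinarith)
  linarith

/-- The concave quadratic upper model `key` does both jobs: it makes `F(x, ·)` small far from the
origin, so the maximum is attained, and its own maximum over `v` is `F + ‖∇_y F‖²/(2μ)`, which is
the PL inequality. -/
theorem StronglyConcaveInY.plInY {F : Joint d₁ d₂ → ℝ} {μ : ℝ} (hF : Differentiable ℝ F)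
    (hμ : 0 < μ) (h : StronglyConcaveInY μ F) : PLInY μ F := by
  have key : ∀ x y v, F (pair x (y + v)) ≤
      F (pair x y) + ⟪gradY F (pair x y), v⟫ - μ / 2 * ‖v‖ ^ 2 := by
    intro x y v
    refine (h x).le_linearization ?_
    have h1 := hasDerivAt_comp_line hF (pair x y) (pair 0 v) 0
    have h2 : ∀ s : ℝ, pair x y + s • pair (0 : Vec d₁) v = pair x (y + s • v) := by
      intro s
      have : s • pair (0 : Vec d₁) v = pair 0 (s • v) := by
        rw [← pair_fst_snd (s • pair (0 : Vec d₁) v)]; simp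
      rw [this, ← pair_add, add_zero]
    simp only [h2, zero_smul, add_zero] at h1
    rw [inner_eq, pair_fst, pair_snd, inner_zero_right, zero_add] at h1
    exact h1
  intro x
  have hc : Continuous fun y : Vec d₂ => F (pair x y) :=
    hF.continuous.comp (continuous_pair.comp (Continuous.prodMk_right x))
  have hmax : ∃ y', ∀ y, F (pair x y) ≤ F (pair x y') := by
    refine hc.exists_forall_ge' (x₀ := 0) ?_
    set g := gradY F (pair x (0 : Vec d₂))
    -- Beyond this radius the quadratic term `μ/2 ‖y‖²` dominates the linear term `‖g‖‖y‖`.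
    have : ∀ᶠ y in Filter.cocompact (Vec d₂), 2 * ‖g‖ / μ ≤ ‖y‖ :=
      tendsto_norm_cocompact_atTop.eventually_ge_atTop _
    filter_upwards [this] with y hy
    have h1 := key x 0 y
    rw [zero_add] at h1
    have h2 : ⟪g, y⟫ ≤ ‖g‖ * ‖y‖ := real_inner_le_norm _ _
    rw [div_le_iff₀ hμ] at hy
    have h3 := mul_le_mul_of_nonneg_right hy (norm_nonneg y)
    change F (pair x y) ≤ F (pair x 0) + ⟪g, y⟫ - _ at h1
    nlinarith
  refine ⟨hmax, fun y => ?_⟩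
  obtain ⟨y', hy'⟩ := hmax
  rw [envelope_eq_of_isMax hy']
  have h1 := key x y (y' - y)
  rw [add_sub_cancel] at h1
  have h2 := real_inner_le_norm (gradY F (pair x y)) (y' - y)
  nlinarith [sq_nonneg (‖gradY F (pair x y)‖ - μ * ‖y' - y‖)]

end StrongConcavity

end LocalSGDA

/-! ### Averages over the clients and the averaged loss. -/

namespace LocalSGDA

open scoped Gradient RealInnerProductSpace

section Mean

variable {n : ℕ}

theorem mean_const {E : Type*} [AddCommGroup E] [Module ℝ E] (hn : 1 ≤ n) (c : E) :
    mean (fun _ : Fin n => c) = c := by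
  have : (n : ℝ) ≠ 0 := by positivity
  rw [mean, Finset.sum_const, Finset.card_univ, Fintype.card_fin, ← Nat.cast_smul_eq_nsmul ℝ,
    smul_smul, inv_mul_cancel₀ this, one_smul]

theorem mean_add {E : Type*} [AddCommGroup E] [Module ℝ E] (v w : Fin n → E) :
    (mean fun i => v i + w i) = mean v + mean w := by
  simp [mean, Finset.sum_add_distrib]

theorem mean_sub {E : Type*} [AddCommGroup E] [Module ℝ E] (v w : Fin n → E) :
    (mean fun i => v i - w i) = mean v - mean w := by
  simp [mean, Finset.sum_sub_distrib, smul_sub]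

theorem map_mean {E F : Type*} [AddCommGroup E] [Module ℝ E] [AddCommGroup F] [Module ℝ F]
    (ℓ : E →ₗ[ℝ] F) (v : Fin n → E) : ℓ (mean v) = mean fun i => ℓ (v i) := by
  simp [mean]

theorem mean_mul_left (c : ℝ) (v : Fin n → ℝ) : (mean fun i => c * v i) = c * mean v := by
  simp [mean, ← Finset.mul_sum]; ring

theorem mean_mono {v w : Fin n → ℝ} (h : ∀ i, v i ≤ w i) : mean v ≤ mean w := by
  simp only [mean, smul_eq_mul]
  gcongr with i
  exact h i

theorem mean_nonneg {v : Fin n → ℝ} (h : ∀ i, 0 ≤ v i) : 0 ≤ mean v := by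
  rw [mean, smul_eq_mul]
  exact mul_nonneg (by positivity) (Finset.sum_nonneg fun i _ => h i)

/-- The mean of the squared distances to a point is smallest at the mean. -/
theorem mean_norm_sub_mean_sq {E : Type*} [NormedAddCommGroup E] [InnerProductSpace ℝ E]
    (hn : 1 ≤ n) (v : Fin n → E) (c : E) :
    (mean fun i => ‖v i - c‖ ^ 2) = (mean fun i => ‖v i - mean v‖ ^ 2) + ‖mean v - c‖ ^ 2 := by
  have h1 : ∀ i, ‖v i - c‖ ^ 2 = ‖v i - mean v‖ ^ 2 + 2 * ⟪v i - mean v, mean v - c⟫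
      + ‖mean v - c‖ ^ 2 := by
    intro i
    rw [← norm_add_sq_real, sub_add_sub_cancel]
  have h2 : (mean fun i => ⟪v i - mean v, mean v - c⟫) = 0 := by
    have := map_mean (innerₗ E (mean v - c)) fun i => v i - mean v
    rw [mean_sub, mean_const hn, sub_self, map_zero] at this
    simp only [innerₗ_apply_apply] at this
    simp only [real_inner_comm (mean v - c)] at this ⊢
    exact this.symm
  simp only [h1]
  rw [mean_add, mean_add, mean_const hn, mean_mul_left, h2]
  ring

theorem norm_mean_sq_le {E : Type*} [NormedAddCommGroup E] [InnerProductSpace ℝ E]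
    (hn : 1 ≤ n) (v : Fin n → E) : ‖mean v‖ ^ 2 ≤ mean fun i => ‖v i‖ ^ 2 := by
  have h1 := mean_norm_sub_mean_sq hn v 0
  simp only [sub_zero] at h1
  have h2 : 0 ≤ mean fun i => ‖v i - mean v‖ ^ 2 := mean_nonneg fun i => sq_nonneg _
  linarith

end Mean

variable {d₁ d₂ n : ℕ}

section GlobalLoss

variable {f : Fin n → Joint d₁ d₂ → ℝ} {L : ℝ}

theorem Smooth.hasGradientAt_globalLoss (hf : Smooth L f) (z : Joint d₁ d₂) :
    HasGradientAt (globalLoss f) (mean fun i => ∇ (f i) z) z := by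
  rw [hasGradientAt_iff_hasFDerivAt]
  have h1 : HasFDerivAt (fun z => ∑ i, f i z) (∑ i, fderiv ℝ (f i) z) z :=
    HasFDerivAt.fun_sum fun i _ => ((hf i).1 z).hasFDerivAt
  have h2 := h1.const_smul (n : ℝ)⁻¹
  refine h2.congr_fderiv ?_
  rw [mean, map_smulₛₗ, map_sum]
  simp

theorem Smooth.differentiable_globalLoss (hf : Smooth L f) : Differentiable ℝ (globalLoss f) :=
  fun z => (hf.hasGradientAt_globalLoss z).differentiableAt

theorem Smooth.gradient_globalLoss (hf : Smooth L f) (z : Joint d₁ d₂) :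
    ∇ (globalLoss f) z = mean fun i => ∇ (f i) z := (hf.hasGradientAt_globalLoss z).gradient

/-- The mean of the local gradients at the local models is close to the global gradient. -/
theorem Smooth.norm_mean_gradient_sub_sq_le (hn : 1 ≤ n) (hf : Smooth L f)
    (z : Fin n → Joint d₁ d₂) (w : Joint d₁ d₂) :
    ‖(mean fun i => ∇ (f i) (z i)) - ∇ (globalLoss f) w‖ ^ 2
      ≤ L ^ 2 * mean fun i => ‖z i - w‖ ^ 2 := by
  rw [hf.gradient_globalLoss, ← mean_sub, ← mean_mul_left]
  refine (norm_mean_sq_le hn _).trans (mean_mono fun i => ?_)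
  rw [← mul_pow]
  gcongr
  exact (hf i).2 _ _

theorem Smooth.globalLoss_lipschitz (hn : 1 ≤ n) (hL : 0 ≤ L) (hf : Smooth L f)
    (z z' : Joint d₁ d₂) :
    ‖∇ (globalLoss f) z - ∇ (globalLoss f) z'‖ ≤ L * ‖z - z'‖ := by
  have h1 := hf.norm_mean_gradient_sub_sq_le hn (fun _ => z) z'
  rw [mean_const hn, ← hf.gradient_globalLoss, ← mul_pow] at h1
  exact le_of_sq_le_sq h1 (by positivity)

end GlobalLoss

/-! ### One local step and the growth of the spread. -/

section Step

/-- The displacement of a descent-ascent step along `g`. -/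
noncomputable def displacement (ηx ηy : ℝ) : Joint d₁ d₂ →ₗ[ℝ] Joint d₁ d₂ where
  toFun g := pair (-(ηx • g.fst)) (ηy • g.snd)
  map_add' g h := by
    rw [← pair_add, WithLp.add_fst, WithLp.add_snd, smul_add, smul_add, neg_add]
  map_smul' c g := by
    rw [← pair_fst_snd (_ • pair _ _), WithLp.smul_fst, WithLp.smul_snd, WithLp.smul_fst,
      WithLp.smul_snd, pair_fst, pair_snd, RingHom.id_apply, smul_neg, smul_comm c, smul_comm c]

theorem descentAscent_eq (ηx ηy : ℝ) (z g : Joint d₁ d₂) :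
    descentAscent ηx ηy z g = z + displacement ηx ηy g := by
  rw [← pair_fst_snd z]
  change _ = pair _ _ + pair _ _
  rw [← pair_add, descentAscent, sub_eq_add_neg]; rfl

theorem norm_displacement_sq_le {ηx ηy : ℝ} (hx : 0 ≤ ηx) (hxy : ηx ≤ ηy) (g : Joint d₁ d₂) :
    ‖displacement ηx ηy g‖ ^ 2 ≤ ηy ^ 2 * ‖g‖ ^ 2 := by
  rw [norm_sq_eq, norm_sq_eq g]
  change ‖-(ηx • g.fst)‖ ^ 2 + ‖ηy • g.snd‖ ^ 2 ≤ _
  rw [norm_neg, norm_smul, norm_smul, mul_pow, mul_pow, Real.norm_of_nonneg hx,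
    Real.norm_of_nonneg (hx.trans hxy), mul_add]
  gcongr

/-- One local step of every client, without communication. -/
noncomputable def localStep {Ξ : Fin n → Type*} (G : ∀ i, Joint d₁ d₂ → Ξ i → Joint d₁ d₂) (ηx ηy : ℝ)
    (z : Fin n → Joint d₁ d₂) (ζ : ∀ i, Ξ i) (i : Fin n) : Joint d₁ d₂ :=
  descentAscent ηx ηy (z i) (G i (z i) (ζ i))

/-- The step is affine in the model and the gradient, so the average model makes a single step along
the averaged stochastic gradient. -/
theorem mean_localStep {Ξ : Fin n → Type*} (G : ∀ i, Joint d₁ d₂ → Ξ i → Joint d₁ d₂)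
    (ηx ηy : ℝ) (z : Fin n → Joint d₁ d₂) (ζ : ∀ i, Ξ i) :
    mean (localStep G ηx ηy z ζ) =
      descentAscent ηx ηy (mean z) (mean fun i => G i (z i) (ζ i)) := by
  rw [descentAscent_eq, map_mean, ← mean_add]
  congr 1

/-- The error of the stochastic gradient of client `i` at its model. -/
noncomputable def noise {Ξ : Fin n → Type*} (f : Fin n → Joint d₁ d₂ → ℝ)
    (G : ∀ i, Joint d₁ d₂ → Ξ i → Joint d₁ d₂) (z : Fin n → Joint d₁ d₂) (ζ : ∀ i, Ξ i)
    (i : Fin n) : Joint d₁ d₂ :=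
  G i (z i) (ζ i) - ∇ (f i) (z i)

/-- The mean squared distance of the local models to their average. -/
noncomputable def spread (z : Fin n → Joint d₁ d₂) : ℝ := mean fun i => ‖z i - mean z‖ ^ 2

theorem spread_nonneg (z : Fin n → Joint d₁ d₂) : 0 ≤ spread z := mean_nonneg fun _ => sq_nonneg _

theorem spread_const (hn : 1 ≤ n) (z : Joint d₁ d₂) : spread (fun _ : Fin n => z) = 0 := by
  simp only [spread, mean_const hn, sub_self, norm_zero]
  norm_num [mean]

theorem norm_add_sq_le_of_pos {E : Type*} [NormedAddCommGroup E] (a b : E) {t : ℝ} (ht : 0 < t) :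
    ‖a + b‖ ^ 2 ≤ (1 + 1 / t) * ‖a‖ ^ 2 + (1 + t) * ‖b‖ ^ 2 := by
  have h1 : ‖a + b‖ ^ 2 ≤ (‖a‖ + ‖b‖) ^ 2 := by gcongr; exact norm_add_le a b
  have h2 : (1 + 1 / t) * ‖a‖ ^ 2 + (1 + t) * ‖b‖ ^ 2 - (‖a‖ + ‖b‖) ^ 2 =
      (‖a‖ - t * ‖b‖) ^ 2 / t := by field_simp; ring
  have h3 : 0 ≤ (‖a‖ - t * ‖b‖) ^ 2 / t := by positivity
  linarith

theorem norm_add_add_sq_le {E : Type*} [NormedAddCommGroup E] (a b c : E) :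
    ‖a + b + c‖ ^ 2 ≤ 3 * (‖a‖ ^ 2 + ‖b‖ ^ 2 + ‖c‖ ^ 2) := by
  have h1 : ‖a + b + c‖ ^ 2 ≤ (‖a‖ + ‖b‖ + ‖c‖) ^ 2 := by gcongr; exact norm_add₃_le
  nlinarith [sq_nonneg (‖a‖ - ‖b‖), sq_nonneg (‖a‖ - ‖c‖), sq_nonneg (‖b‖ - ‖c‖)]

/-- The growth of the spread in one local step. -/
theorem spread_localStep_le {Ξ : Fin n → Type*} (hn : 1 ≤ n) {f : Fin n → Joint d₁ d₂ → ℝ}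
    (G : ∀ i, Joint d₁ d₂ → Ξ i → Joint d₁ d₂) {L ςx ςy ηx ηy τ : ℝ} (hf : Smooth L f)
    (hhet : BoundedHeterogeneity ςx ςy f) (hx : 0 ≤ ηx) (hxy : ηx ≤ ηy) (hτ : 0 < τ)
    (z : Fin n → Joint d₁ d₂) (ζ : ∀ i, Ξ i) :
    spread (localStep G ηx ηy z ζ) ≤ (1 + 1 / τ) * spread z + (1 + τ) * (ηy ^ 2 *
      (3 * ((mean fun i => ‖noise f G z ζ i‖ ^ 2) + L ^ 2 * spread z + (ςx ^ 2 + ςy ^ 2)))) := by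
  set zb := mean z with hzb
  set g : Fin n → Joint d₁ d₂ := fun i => G i (z i) (ζ i) with hg
  have h1 : (mean fun i => ‖g i - ∇ (globalLoss f) zb‖ ^ 2) ≤
      3 * ((mean fun i => ‖noise f G z ζ i‖ ^ 2) + L ^ 2 * spread z + (ςx ^ 2 + ςy ^ 2)) := by
    have e1 : ∀ i, ‖g i - ∇ (globalLoss f) zb‖ ^ 2 ≤ 3 * (‖noise f G z ζ i‖ ^ 2 +
        L ^ 2 * ‖z i - zb‖ ^ 2 + (‖gradX (f i) zb - gradX (globalLoss f) zb‖ ^ 2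
          + ‖gradY (f i) zb - gradY (globalLoss f) zb‖ ^ 2)) := by
      intro i
      have e2 : g i - ∇ (globalLoss f) zb = noise f G z ζ i + (∇ (f i) (z i) - ∇ (f i) zb) +
          (∇ (f i) zb - ∇ (globalLoss f) zb) := by
        simp only [noise, hg]; abel
      have e3 : ‖∇ (f i) zb - ∇ (globalLoss f) zb‖ ^ 2 =
          ‖gradX (f i) zb - gradX (globalLoss f) zb‖ ^ 2
          + ‖gradY (f i) zb - gradY (globalLoss f) zb‖ ^ 2 := norm_sq_eq _
      rw [e2, ← e3, ← mul_pow]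
      refine (norm_add_add_sq_le _ _ _).trans ?_
      gcongr
      exact (hf i).2 _ _
    refine (mean_mono e1).trans ?_
    rw [mean_mul_left, mean_add, mean_add, mean_mul_left, mean_add]
    have h2 := hhet zb
    rw [spread]
    linarith
  -- Since the mean minimizes the mean squared distance, the displacements may be centred at this
  -- common vector instead of at `mean b`; the deviations then split into noise, smoothness and
  -- heterogeneity.
  set c := displacement ηx ηy (∇ (globalLoss f) zb) with hc
  set b : Fin n → Joint d₁ d₂ := fun i => displacement ηx ηy (g i) with hb
  have h2 : (mean fun i => ‖b i - mean b‖ ^ 2) ≤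
      ηy ^ 2 * mean fun i => ‖g i - ∇ (globalLoss f) zb‖ ^ 2 := by
    have e1 := mean_norm_sub_mean_sq hn b c
    have e2 : (mean fun i => ‖b i - c‖ ^ 2) ≤
        ηy ^ 2 * mean fun i => ‖g i - ∇ (globalLoss f) zb‖ ^ 2 := by
      rw [← mean_mul_left]
      refine mean_mono fun i => ?_
      rw [hb, hc, ← map_sub]
      exact norm_displacement_sq_le hx hxy _
    nlinarith [sq_nonneg ‖mean b - c‖]
  have h3 : ∀ i, ‖localStep G ηx ηy z ζ i - mean (localStep G ηx ηy z ζ)‖ ^ 2 ≤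
      (1 + 1 / τ) * ‖z i - zb‖ ^ 2 + (1 + τ) * ‖b i - mean b‖ ^ 2 := by
    intro i
    have e1 : localStep G ηx ηy z ζ i - mean (localStep G ηx ηy z ζ) =
        (z i - zb) + (b i - mean b) := by
      rw [mean_localStep, localStep, descentAscent_eq, descentAscent_eq, map_mean]
      simp only [hb, hg]; abel
    rw [e1]
    -- The Young weight is `τ` so that the factor `1 + 1/τ` compounds to a bounded constant over a
    -- round of `τ` steps.
    exact norm_add_sq_le_of_pos _ _ hτ
  refine (mean_mono h3).trans ?_
  rw [mean_add, mean_mul_left, mean_mul_left]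
  have h4 := h2.trans (mul_le_mul_of_nonneg_left h1 (sq_nonneg ηy))
  have h5 : (0 : ℝ) ≤ 1 + τ := by positivity
  have h6 := mul_le_mul_of_nonneg_left h4 h5
  rw [spread] at *
  linarith

end Step

/-! ### Deterministic decrease of the potential. -/

section Descent

/-- The `x`-part of the descent, with `a = ∇Φ`, `e = ∇Φ - ∇ₓF` and `r` the gradient error. Since `⟪a
+ e, a - e⟫ = ‖a‖² - ‖e‖²`, the mismatch `e` enters only through its square. -/
theorem neg_inner_add_norm_sq_le {E : Type*} [NormedAddCommGroup E] [InnerProductSpace ℝ E]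
    (a e r : E) {c : ℝ} (hc : c ≤ 1 / 24) :
    -⟪a + e, a - e + r⟫ + c * ‖a - e + r‖ ^ 2 ≤
      -(1 / 2) * ‖a‖ ^ 2 + 3 / 2 * ‖e‖ ^ 2 + 3 * ‖r‖ ^ 2 := by
  have h1 : ⟪a + e, a - e + r⟫ = ‖a‖ ^ 2 - ‖e‖ ^ 2 + ⟪a, r⟫ + ⟪e, r⟫ := by
    simp only [inner_add_left, inner_add_right, inner_sub_right, real_inner_self_eq_norm_sq,
      real_inner_comm a e]
    ring
  have h2 : ‖a - e + r‖ ^ 2 ≤ 3 * (‖a‖ ^ 2 + ‖e‖ ^ 2 + ‖r‖ ^ 2) := by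
    have := norm_add_add_sq_le a (-e) r
    rwa [norm_neg, ← sub_eq_add_neg] at this
  have h3 := (abs_le.1 (abs_real_inner_le_norm a r)).1
  have h4 := (abs_le.1 (abs_real_inner_le_norm e r)).1
  have h5 : c * ‖a - e + r‖ ^ 2 ≤ 1 / 24 * (3 * (‖a‖ ^ 2 + ‖e‖ ^ 2 + ‖r‖ ^ 2)) := by gcongr
  rw [h1]
  nlinarith [sq_nonneg (‖a‖ / 2 - ‖r‖), sq_nonneg (‖e‖ / 2 - ‖r‖), sq_nonneg ‖r‖,
    sq_nonneg ‖a‖, sq_nonneg ‖e‖]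

/-- The `y`-part, with `p = ∇_y F`. The gain `5/8` must exceed the `9/16` that the `x`-part consumes
through its mismatch term. -/
theorem neg_inner_self_add_norm_sq_le {E : Type*} [NormedAddCommGroup E] [InnerProductSpace ℝ E]
    (p r : E) {c : ℝ} (hc : c ≤ 1 / 16) :
    -⟪p, p + r⟫ + c * ‖p + r‖ ^ 2 ≤ -(5 / 8) * ‖p‖ ^ 2 + 9 / 8 * ‖r‖ ^ 2 := by
  have h1 : ⟪p, p + r⟫ = ‖p‖ ^ 2 + ⟪p, r⟫ := by
    rw [inner_add_right, real_inner_self_eq_norm_sq]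
  have h2 := norm_add_sq_le_of_pos p r one_pos
  have h3 := (abs_le.1 (abs_real_inner_le_norm p r)).1
  have h5 : c * ‖p + r‖ ^ 2 ≤ 1 / 16 * ‖p + r‖ ^ 2 := by gcongr
  rw [h1]
  nlinarith [sq_nonneg (‖p‖ / 2 - ‖r‖)]

/-- The potential `2 Φ(x) - F(x, y) = Φ(x) + (Φ(x) - F(x, y))`. -/
noncomputable def potential (F : Joint d₁ d₂ → ℝ) (z : Joint d₁ d₂) : ℝ := 2 * envelope F z.fst - F z

/-- The potential decreases in a step along an inexact gradient `g + N`, up to terms that are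
linear or quadratic in `N`. -/
theorem potential_descentAscent_le {F : Joint d₁ d₂ → ℝ} {L μ κ ηx ηy : ℝ}
    (hF : Differentiable ℝ F) (hL : ∀ z z', ‖∇ F z - ∇ F z'‖ ≤ L * ‖z - z'‖) (hμ : 0 < μ)
    (hμL : μ ≤ L) (hκ : κ = L / μ) (hPL : PLInY μ F) (hηy : 0 < ηy) (hηx : ηx = ηy / (8 * κ ^ 2))
    (hsmall : L * ηy ≤ 1 / 8) (z g : Joint d₁ d₂) :
    ∃ b : Joint d₁ d₂, ∀ N, potential F (descentAscent ηx ηy z (g + N)) ≤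
      potential F z - ηx / 2 * ‖∇ (envelope F) z.fst‖ ^ 2 + 2 * ηy * ‖g - ∇ F z‖ ^ 2
        + ⟪b, N⟫ + L / 2 * ηy ^ 2 * ‖N‖ ^ 2 := by
  have hL0 : 0 < L := hμ.trans_le hμL
  have hκ1 : 1 ≤ κ := by rw [hκ]; exact (one_le_div hμ).2 hμL
  have hκ0 : 0 < κ := one_pos.trans_le hκ1
  have hηx0 : 0 < ηx := by rw [hηx]; positivity
  have hxy : ηx * κ ^ 2 = ηy / 8 := by rw [hηx]; field_simp
  have hLμ : L ^ 2 / μ = L * κ := by rw [hκ]; field_simp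
  set a := ∇ (envelope F) z.fst with ha
  set px := gradX F z with hpx
  set py := gradY F z with hpy
  -- The curvature of the potential in `x`: `2 · (L + L²/μ)/2` from `2Φ` and `L/2` from `-F`.
  set cx := 3 / 2 * L + L * κ with hcx
  have hcx' : cx ≤ 5 / 2 * L * κ := by nlinarith
  have hcx0 : 0 < cx := by positivity
  have hcxη : cx * ηx ≤ 1 / 24 := by
    have h1 : cx * ηx * κ ≤ 5 / 2 * L * (ηy / 8) := by
      rw [← hxy]
      calc cx * ηx * κ ≤ 5 / 2 * L * κ * ηx * κ := by gcongr
        _ = _ := by ring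
    have h2 : cx * ηx ≤ cx * ηx * κ := le_mul_of_one_le_right (by positivity) hκ1
    linarith
  have hxle : ηx ≤ ηy / 8 := by
    rw [← hxy]; exact le_mul_of_one_le_right hηx0.le (one_le_pow₀ hκ1)
  have hcxη2 : cx * ηx ^ 2 ≤ L / 2 * ηy ^ 2 := by
    have h0 : cx * ηx ≤ 5 / 2 * L * (ηy / 8) := by
      rw [← hxy]
      calc cx * ηx ≤ 5 / 2 * L * κ * ηx := by gcongr
        _ = 5 / 2 * L * (ηx * κ) := by ring
        _ ≤ 5 / 2 * L * (ηx * κ ^ 2) := by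
          gcongr; exact le_self_pow₀ hκ1 two_ne_zero
    calc cx * ηx ^ 2 = cx * ηx * ηx := by ring
      _ ≤ 5 / 2 * L * (ηy / 8) * (ηy / 8) := by gcongr
      _ ≤ L / 2 * ηy ^ 2 := by nlinarith [mul_pos hL0 (pow_pos hηy 2)]
  -- This vector collects every term linear in `N`, including the cross terms of the squared norms.
  -- It depends on `z` and `g` only, so its contribution has mean zero.
  refine ⟨pair (-(2 * ηx) • a + ηx • px + (2 * ηx ^ 2 * cx) • g.fst)
    (-ηy • py + (ηy ^ 2 * L) • g.snd), fun N => ?_⟩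
  set u : Vec d₁ := -(ηx • (g + N).fst) with hu
  set v : Vec d₂ := ηy • (g + N).snd with hv
  have hz' : descentAscent ηx ηy z (g + N) = z + pair u v := descentAscent_eq ..
  have h1 := envelope_add_le_gradient hF hL hL0 hμ hPL z.fst u
  have h2 := (abs_le.1 (abs_sub_linearization_le hF hL z (pair u v))).1
  rw [norm_sq_eq, inner_eq] at h2
  simp only [pair_fst, pair_snd] at h2
  change _ ≤ F (z + pair u v) - F z - (⟪px, u⟫ + ⟪py, v⟫) at h2
  have hnu : ‖u‖ ^ 2 = ηx ^ 2 * (‖g.fst‖ ^ 2 + 2 * ⟪g.fst, N.fst⟫ + ‖N.fst‖ ^ 2) := by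
    rw [hu, norm_neg, norm_smul, mul_pow, Real.norm_of_nonneg hηx0.le, WithLp.add_fst,
      norm_add_sq_real]
  have hnv : ‖v‖ ^ 2 = ηy ^ 2 * (‖g.snd‖ ^ 2 + 2 * ⟪g.snd, N.snd⟫ + ‖N.snd‖ ^ 2) := by
    rw [hv, norm_smul, mul_pow, Real.norm_of_nonneg hηy.le, WithLp.add_snd, norm_add_sq_real]
  have hau : ⟪a, u⟫ = -ηx * (⟪a, g.fst⟫ + ⟪a, N.fst⟫) := by
    rw [hu, inner_neg_right, inner_smul_right, WithLp.add_fst, inner_add_right]; ring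
  have hpu : ⟪px, u⟫ = -ηx * (⟪px, g.fst⟫ + ⟪px, N.fst⟫) := by
    rw [hu, inner_neg_right, inner_smul_right, WithLp.add_fst, inner_add_right]; ring
  have hpv : ⟪py, v⟫ = ηy * (⟪py, g.snd⟫ + ⟪py, N.snd⟫) := by
    rw [hv, inner_smul_right, WithLp.add_snd, inner_add_right]
  have hb : ⟪pair (-(2 * ηx) • a + ηx • px + (2 * ηx ^ 2 * cx) • g.fst)
      (-ηy • py + (ηy ^ 2 * L) • g.snd), N⟫ = -(2 * ηx) * ⟪a, N.fst⟫ + ηx * ⟪px, N.fst⟫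
        + 2 * ηx ^ 2 * cx * ⟪g.fst, N.fst⟫ - ηy * ⟪py, N.snd⟫ + ηy ^ 2 * L * ⟪g.snd, N.snd⟫ := by
    rw [inner_eq]
    simp only [pair_fst, pair_snd, inner_add_left, real_inner_smul_left]
    ring
  have hdetx : -(2 * ηx) * ⟪a, g.fst⟫ + ηx * ⟪px, g.fst⟫ + cx * ηx ^ 2 * ‖g.fst‖ ^ 2 ≤
      ηx * (-(1 / 2) * ‖a‖ ^ 2 + 3 / 2 * ‖a - px‖ ^ 2 + 3 * ‖g.fst - px‖ ^ 2) := by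
    have e1 := neg_inner_add_norm_sq_le a (a - px) (g.fst - px) hcxη
    have e2 : a - (a - px) + (g.fst - px) = g.fst := by abel
    have e3 : ⟪a + (a - px), g.fst⟫ = 2 * ⟪a, g.fst⟫ - ⟪px, g.fst⟫ := by
      rw [inner_add_left, inner_sub_left]; ring
    rw [e2, e3] at e1
    have e4 := mul_le_mul_of_nonneg_left e1 hηx0.le
    linarith
  have hdety : -ηy * ⟪py, g.snd⟫ + L / 2 * ηy ^ 2 * ‖g.snd‖ ^ 2 ≤
      ηy * (-(5 / 8) * ‖py‖ ^ 2 + 9 / 8 * ‖g.snd - py‖ ^ 2) := by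
    have e1 := neg_inner_self_add_norm_sq_le py (g.snd - py) (c := L / 2 * ηy)
      (by linarith)
    rw [add_sub_cancel] at e1
    have e4 := mul_le_mul_of_nonneg_left e1 hηy.le
    linarith
  have herr : ‖a - px‖ ^ 2 ≤ 3 * κ ^ 2 * ‖py‖ ^ 2 := by
    rw [hκ]; exact norm_gradient_envelope_sub_gradX_sq_le hF hL hμ hμL hPL z.fst z.snd
  -- Here the ratio of the step sizes cancels `κ²`: the mismatch `3/2 · ηx‖a - px‖²` costs at most
  -- `9/16 · ηy‖py‖²`.
  have herr' : ηx * ‖a - px‖ ^ 2 ≤ 3 * (ηy / 8) * ‖py‖ ^ 2 := by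
    rw [← hxy]
    calc _ ≤ ηx * (3 * κ ^ 2 * ‖py‖ ^ 2) := by gcongr
      _ = _ := by ring
  have hr : ‖g - ∇ F z‖ ^ 2 = ‖g.fst - px‖ ^ 2 + ‖g.snd - py‖ ^ 2 := norm_sq_eq _
  have hN := norm_sq_eq N
  have hrx : ηx * ‖g.fst - px‖ ^ 2 ≤ ηy / 8 * ‖g.fst - px‖ ^ 2 := by gcongr
  have hNx : cx * ηx ^ 2 * ‖N.fst‖ ^ 2 ≤ L / 2 * ηy ^ 2 * ‖N.fst‖ ^ 2 := by gcongr
  have hq : 0 ≤ ηy * ‖py‖ ^ 2 := by positivity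
  have hr1 : 0 ≤ ηy * ‖g.fst - px‖ ^ 2 := by positivity
  have hr2 : 0 ≤ ηy * ‖g.snd - py‖ ^ 2 := by positivity
  have hpot : potential F (z + pair u v) ≤ potential F z + 2 * ⟪a, u⟫ - ⟪px, u⟫ - ⟪py, v⟫
      + cx * ‖u‖ ^ 2 + L / 2 * ‖v‖ ^ 2 := by
    simp only [potential]
    rw [WithLp.add_fst, pair_fst, hcx]
    rw [hLμ] at h1
    linarith
  rw [hau, hpu, hpv, hnu, hnv] at hpot
  rw [hz', hb, hr, hN]
  linarith

end Descent

end LocalSGDA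

/-! ### Moments of the oracle noise at frozen local models, under the product law of one round of
samples. -/

namespace LocalSGDA

open scoped Gradient RealInnerProductSpace

variable {d₁ d₂ n : ℕ}

section Oracle

variable {Ξ : Fin n → Type*} [∀ i, MeasurableSpace (Ξ i)] {𝒟 : ∀ i, Measure (Ξ i)}
  [∀ i, IsProbabilityMeasure (𝒟 i)] {σ : ℝ} {f : Fin n → Joint d₁ d₂ → ℝ}
  {G : ∀ i, Joint d₁ d₂ → Ξ i → Joint d₁ d₂}

theorem integral_mean {Ω E : Type*} [MeasurableSpace Ω] {P : Measure Ω} [NormedAddCommGroup E]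
    [NormedSpace ℝ E] {h : Fin n → Ω → E} (hh : ∀ i, Integrable (h i) P) :
    ∫ ω, (mean fun i => h i ω) ∂P = mean fun i => ∫ ω, h i ω ∂P := by
  simp only [mean]
  rw [integral_smul, integral_finsetSum _ fun i _ => hh i]

theorem integrable_mean {Ω E : Type*} [MeasurableSpace Ω] {P : Measure Ω} [NormedAddCommGroup E]
    [NormedSpace ℝ E] {h : Fin n → Ω → E} (hh : ∀ i, Integrable (h i) P) :
    Integrable (fun ω => mean fun i => h i ω) P := by
  simp only [mean]
  exact (integrable_finsetSum _ fun i _ => hh i).smul _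

theorem memLp_mean {Ω E : Type*} [MeasurableSpace Ω] {P : Measure Ω} [NormedAddCommGroup E]
    [NormedSpace ℝ E] {p : ℝ≥0∞} {h : Fin n → Ω → E} (hh : ∀ i, MemLp (h i) p P) :
    MemLp (fun ω => mean fun i => h i ω) p P := by
  simp only [mean]
  exact (memLp_finsetSum _ fun i _ => hh i).const_smul _

theorem integrable_inner_of_memLp {Ω E : Type*} [MeasurableSpace Ω] {P : Measure Ω}
    [NormedAddCommGroup E] [InnerProductSpace ℝ E] {X Y : Ω → E} (hX : MemLp X 2 P)
    (hY : MemLp Y 2 P) : Integrable (fun ω => ⟪X ω, Y ω⟫) P := by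
  refine (hX.norm.integrable_mul hY.norm).mono' (hX.1.inner hY.1)
    (Filter.Eventually.of_forall fun ω => ?_)
  exact norm_inner_le_norm _ _

variable (hG : UnbiasedBoundedVariance σ f 𝒟 G)
include hG

theorem UnbiasedBoundedVariance.integrable_sub (i : Fin n) (z : Joint d₁ d₂) :
    Integrable (fun ξ => G i z ξ - ∇ (f i) z) (𝒟 i) :=
  ((hG i).2 z).1.sub (integrable_const _)

theorem UnbiasedBoundedVariance.integrable_noise (z : Fin n → Joint d₁ d₂) (i : Fin n) :
    Integrable (fun ζ => noise f G z ζ i) (Measure.pi 𝒟) :=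
  integrable_comp_eval (hG.integrable_sub i (z i))

theorem UnbiasedBoundedVariance.integral_noise (z : Fin n → Joint d₁ d₂) (i : Fin n) :
    ∫ ζ, noise f G z ζ i ∂(Measure.pi 𝒟) = 0 := by
  have h1 := integral_comp_eval (μ := 𝒟) (i := i) (hG.integrable_sub i (z i)).aestronglyMeasurable
  have h2 := (hG i).2 (z i)
  rw [integral_sub h2.1 (integrable_const _), h2.2.1, integral_const, probReal_univ, one_smul,
    sub_self] at h1
  exact h1

theorem UnbiasedBoundedVariance.integrable_norm_noise_sq (z : Fin n → Joint d₁ d₂) (i : Fin n) :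
    Integrable (fun ζ => ‖noise f G z ζ i‖ ^ 2) (Measure.pi 𝒟) :=
  integrable_comp_eval ((hG i).2 (z i)).2.2.1

theorem UnbiasedBoundedVariance.integral_norm_noise_sq_le (z : Fin n → Joint d₁ d₂) (i : Fin n) :
    ∫ ζ, ‖noise f G z ζ i‖ ^ 2 ∂(Measure.pi 𝒟) ≤ σ ^ 2 := by
  have h2 := ((hG i).2 (z i)).2.2
  rw [← integral_comp_eval (μ := 𝒟) h2.1.aestronglyMeasurable] at h2
  exact h2.2

theorem UnbiasedBoundedVariance.integral_mean_norm_noise_sq_le (hn : 1 ≤ n)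
    (z : Fin n → Joint d₁ d₂) :
    ∫ ζ, (mean fun i => ‖noise f G z ζ i‖ ^ 2) ∂(Measure.pi 𝒟) ≤ σ ^ 2 := by
  rw [integral_mean fun i => hG.integrable_norm_noise_sq z i]
  exact (mean_mono fun i => hG.integral_norm_noise_sq_le z i).trans_eq (mean_const hn _)

theorem UnbiasedBoundedVariance.memLp_noise (z : Fin n → Joint d₁ d₂) (i : Fin n) :
    MemLp (fun ζ => noise f G z ζ i) 2 (Measure.pi 𝒟) :=
  (memLp_two_iff_integrable_sq_norm (hG.integrable_noise z i).aestronglyMeasurable).2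
    (hG.integrable_norm_noise_sq z i)

theorem UnbiasedBoundedVariance.integral_inner_noise (z : Fin n → Joint d₁ d₂) {i j : Fin n}
    (hij : i ≠ j) : ∫ ζ, ⟪noise f G z ζ i, noise f G z ζ j⟫ ∂(Measure.pi 𝒟) = 0 := by
  have h1 : iIndepFun (fun i (ζ : ∀ i, Ξ i) => noise f G z ζ i) (Measure.pi 𝒟) :=
    iIndepFun_pi fun i => (hG.integrable_sub i (z i)).aemeasurable
  have h2 := (h1.indepFun hij).integral_bilin (hG.integrable_noise z i) (hG.integrable_noise z j)
    (innerSL ℝ)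
  refine h2.trans ?_
  rw [innerSL_apply_apply, hG.integral_noise, inner_zero_left]

theorem UnbiasedBoundedVariance.integrable_norm_mean_noise_sq (z : Fin n → Joint d₁ d₂) :
    Integrable (fun ζ => ‖mean (noise f G z ζ)‖ ^ 2) (Measure.pi 𝒟) := by
  have h1 : MemLp (fun ζ => mean (noise f G z ζ)) 2 (Measure.pi 𝒟) :=
    memLp_mean fun i => hG.memLp_noise z i
  exact (memLp_two_iff_integrable_sq_norm h1.1).1 h1

/-- Averaging over the clients divides the variance by `n`. -/
theorem UnbiasedBoundedVariance.integral_norm_mean_noise_sq_le (hn : 1 ≤ n)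
    (z : Fin n → Joint d₁ d₂) :
    ∫ ζ, ‖mean (noise f G z ζ)‖ ^ 2 ∂(Measure.pi 𝒟) ≤ σ ^ 2 / n := by
  have hn0 : (0 : ℝ) < n := by positivity
  have hii : ∀ i j, Integrable (fun ζ => ⟪noise f G z ζ i, noise f G z ζ j⟫) (Measure.pi 𝒟) :=
    fun i j => integrable_inner_of_memLp (hG.memLp_noise z i) (hG.memLp_noise z j)
  have h1 : ∀ ζ, ‖mean (noise f G z ζ)‖ ^ 2 =
      (n : ℝ)⁻¹ ^ 2 * ∑ i, ∑ j, ⟪noise f G z ζ i, noise f G z ζ j⟫ := by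
    intro ζ
    rw [mean, norm_smul, mul_pow, Real.norm_of_nonneg (by positivity), ← real_inner_self_eq_norm_sq,
      sum_inner]
    simp only [inner_sum]
  simp only [h1]
  rw [integral_const_mul, integral_finsetSum _ fun i _ => integrable_finsetSum _ fun j _ => hii i j]
  have h2 : ∀ i, ∫ ζ, ∑ j, ⟪noise f G z ζ i, noise f G z ζ j⟫ ∂(Measure.pi 𝒟) ≤ σ ^ 2 := by
    intro i
    rw [integral_finsetSum _ fun j _ => hii i j, Finset.sum_eq_single i
      (fun j _ hj => hG.integral_inner_noise z hj.symm) (fun h => absurd (Finset.mem_univ i) h)]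
    simp only [real_inner_self_eq_norm_sq]
    exact hG.integral_norm_noise_sq_le z i
  calc _ ≤ (n : ℝ)⁻¹ ^ 2 * ∑ _i : Fin n, σ ^ 2 := by gcongr with i; exact h2 i
    _ = σ ^ 2 / n := by
      rw [Finset.sum_const, Finset.card_univ, Fintype.card_fin, nsmul_eq_mul]; field_simp

theorem UnbiasedBoundedVariance.integral_inner_mean_noise (z : Fin n → Joint d₁ d₂)
    (b : Joint d₁ d₂) : ∫ ζ, ⟪b, mean (noise f G z ζ)⟫ ∂(Measure.pi 𝒟) = 0 := by
  have h0 : Integrable (fun ζ => mean (noise f G z ζ)) (Measure.pi 𝒟) :=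
    integrable_mean fun i => hG.integrable_noise z i
  have h1 := integral_mean fun i => hG.integrable_noise z i
  rw [integral_inner h0]
  change ⟪b, ∫ ζ, (mean fun i => noise f G z ζ i) ∂(Measure.pi 𝒟)⟫ = 0
  rw [h1]
  simp [hG.integral_noise, mean]

/-- The expected decrease of the potential in one step. -/
theorem UnbiasedBoundedVariance.integral_potential_localStep_le (hn : 1 ≤ n) {L μ κ ηx ηy : ℝ}
    (hf : Smooth L f) (hμ : 0 < μ) (hμL : μ ≤ L) (hκ : κ = L / μ) (hPL : PLInY μ (globalLoss f))
    (hηy : 0 < ηy) (hηx : ηx = ηy / (8 * κ ^ 2)) (hsmall : L * ηy ≤ 1 / 8)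
    (z : Fin n → Joint d₁ d₂)
    (hint : Integrable (fun ζ => potential (globalLoss f) (mean (localStep G ηx ηy z ζ)))
      (Measure.pi 𝒟)) :
    ∫ ζ, potential (globalLoss f) (mean (localStep G ηx ηy z ζ)) ∂(Measure.pi 𝒟) ≤
      potential (globalLoss f) (mean z) - ηx / 2 * ‖∇ (envelope (globalLoss f)) (mean z).fst‖ ^ 2
        + (2 * ηy * L ^ 2) * spread z + L / 2 * ηy ^ 2 * (σ ^ 2 / n) := by
  have hL0 : 0 < L := hμ.trans_le hμL
  obtain ⟨b, hb⟩ := potential_descentAscent_le hf.differentiable_globalLoss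
    (hf.globalLoss_lipschitz hn hL0.le) hμ hμL hκ hPL hηy hηx hsmall (mean z)
    (mean fun i => ∇ (f i) (z i))
  set A := potential (globalLoss f) (mean z)
    - ηx / 2 * ‖∇ (envelope (globalLoss f)) (mean z).fst‖ ^ 2 + (2 * ηy * L ^ 2) * spread z with hA
  have h1 : ∀ ζ, potential (globalLoss f) (mean (localStep G ηx ηy z ζ)) ≤
      A + ⟪b, mean (noise f G z ζ)⟫ + L / 2 * ηy ^ 2 * ‖mean (noise f G z ζ)‖ ^ 2 := by
    intro ζ
    have e1 : (mean fun i => G i (z i) (ζ i)) =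
        (mean fun i => ∇ (f i) (z i)) + mean (noise f G z ζ) := by
      rw [← mean_add]; simp [noise]
    have e2 := hb (mean (noise f G z ζ))
    have e3 := mul_le_mul_of_nonneg_left (hf.norm_mean_gradient_sub_sq_le hn z (mean z))
      (by positivity : 0 ≤ 2 * ηy)
    rw [mean_localStep, e1]
    rw [spread] at hA
    linarith
  have hi1 : Integrable (fun ζ => ⟪b, mean (noise f G z ζ)⟫) (Measure.pi 𝒟) :=
    (integrable_mean fun i => hG.integrable_noise z i).const_inner b
  have hi2 := (hG.integrable_norm_mean_noise_sq z).const_mul (L / 2 * ηy ^ 2)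
  refine (integral_mono hint (((integrable_const A).add hi1).add hi2) h1).trans ?_
  refine (integral_add ((integrable_const A).add hi1) hi2).trans_le ?_
  rw [integral_add' (integrable_const A) hi1,
    integral_const, probReal_univ, one_smul, hG.integral_inner_mean_noise, integral_const_mul,
    add_zero]
  gcongr
  exact hG.integral_norm_mean_noise_sq_le hn z

/-- The expected growth of the spread in one local step. -/
theorem UnbiasedBoundedVariance.integral_spread_localStep_le (hn : 1 ≤ n)
    {L ςx ςy ηx ηy τ : ℝ} (hf : Smooth L f) (hhet : BoundedHeterogeneity ςx ςy f) (hx : 0 ≤ ηx)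
    (hxy : ηx ≤ ηy) (hτ : 0 < τ) (z : Fin n → Joint d₁ d₂)
    (hint : Integrable (fun ζ => spread (localStep G ηx ηy z ζ)) (Measure.pi 𝒟)) :
    ∫ ζ, spread (localStep G ηx ηy z ζ) ∂(Measure.pi 𝒟) ≤
      (1 + 1 / τ + 3 * (1 + τ) * ηy ^ 2 * L ^ 2) * spread z
        + 3 * (1 + τ) * ηy ^ 2 * (σ ^ 2 + ςx ^ 2 + ςy ^ 2) := by
  set A := (1 + 1 / τ + 3 * (1 + τ) * ηy ^ 2 * L ^ 2) * spread z
        + 3 * (1 + τ) * ηy ^ 2 * (ςx ^ 2 + ςy ^ 2)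
  have h1 : ∀ ζ, spread (localStep G ηx ηy z ζ) ≤
      A + 3 * (1 + τ) * ηy ^ 2 * (mean fun i => ‖noise f G z ζ i‖ ^ 2) := fun ζ =>
    (spread_localStep_le hn G hf hhet hx hxy hτ z ζ).trans_eq (by ring)
  have hi := (integrable_mean fun i => hG.integrable_norm_noise_sq z i).const_mul
    (3 * (1 + τ) * ηy ^ 2)
  refine (integral_mono hint ((integrable_const A).add hi) h1).trans ?_
  rw [integral_add' (integrable_const A) hi, integral_const, probReal_univ, one_smul,
    integral_const_mul]
  have h2 := mul_le_mul_of_nonneg_left (hG.integral_mean_norm_noise_sq_le hn z)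
    (by positivity : 0 ≤ 3 * (1 + τ) * ηy ^ 2)
  linarith

end Oracle

/-! ### Conditioning on independent variables. -/

section Independence

/-- Integrating a bound for each value of `X` that averages over an independent `Y`. -/
theorem integral_le_of_indepFun {Ω α β : Type*} [MeasurableSpace Ω] [MeasurableSpace α]
    [MeasurableSpace β] {P : Measure Ω} [IsProbabilityMeasure P] {X : Ω → α} {Y : Ω → β}
    (hX : Measurable X) (hY : Measurable Y) (hXY : IndepFun X Y P) {H : α × β → ℝ}
    (hH : Measurable H) (hint : Integrable (fun ω => H (X ω, Y ω)) P) {B : α → ℝ}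
    (hBm : Measurable B) (hB : Integrable (fun ω => B (X ω)) P)
    (h : ∀ x, Integrable (fun y => H (x, y)) (P.map Y) → ∫ y, H (x, y) ∂(P.map Y) ≤ B x) :
    ∫ ω, H (X ω, Y ω) ∂P ≤ ∫ ω, B (X ω) ∂P := by
  have := Measure.isProbabilityMeasure_map hX.aemeasurable (μ := P)
  have := Measure.isProbabilityMeasure_map hY.aemeasurable (μ := P)
  have hprod := (indepFun_iff_map_prod_eq_prod_map_map hX.aemeasurable hY.aemeasurable).1 hXY
  have hint' : Integrable H ((P.map X).prod (P.map Y)) := by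
    rw [← hprod]
    exact (integrable_map_measure hH.aestronglyMeasurable (hX.prodMk hY).aemeasurable).2 hint
  rw [← integral_map (hX.prodMk hY).aemeasurable hH.aestronglyMeasurable, hprod,
    integral_prod _ hint', ← integral_map hX.aemeasurable hBm.aestronglyMeasurable]
  refine integral_mono_ae hint'.integral_prod_left
    ((integrable_map_measure hBm.aestronglyMeasurable hX.aemeasurable).2 hB) ?_
  -- Fubini gives integrable sections only for almost every `x`; this is why `h` may assume
  -- integrability of the section.
  filter_upwards [hint'.prod_right_ae] with x hx
  exact h x hx

/-- A nonnegative function of independent variables is integrable if its averages over the second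
variable are bounded. -/
theorem integrable_of_indepFun {Ω α β : Type*} [MeasurableSpace Ω] [MeasurableSpace α]
    [MeasurableSpace β] {P : Measure Ω} [IsProbabilityMeasure P] {X : Ω → α} {Y : Ω → β}
    (hX : Measurable X) (hY : Measurable Y) (hXY : IndepFun X Y P) {H : α × β → ℝ}
    (hH : Measurable H) (hH0 : ∀ p, 0 ≤ H p) {c : ℝ}
    (h : ∀ x, Integrable (fun y => H (x, y)) (P.map Y) ∧ ∫ y, H (x, y) ∂(P.map Y) ≤ c) :
    Integrable (fun ω => H (X ω, Y ω)) P := by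
  have := Measure.isProbabilityMeasure_map hX.aemeasurable (μ := P)
  have := Measure.isProbabilityMeasure_map hY.aemeasurable (μ := P)
  have hprod := (indepFun_iff_map_prod_eq_prod_map_map hX.aemeasurable hY.aemeasurable).1 hXY
  refine (integrable_map_measure (g := H) (f := fun ω => (X ω, Y ω)) hH.aestronglyMeasurable
    (hX.prodMk hY).aemeasurable).1 ?_
  rw [hprod, integrable_prod_iff hH.aestronglyMeasurable]
  refine ⟨Filter.Eventually.of_forall fun x => (h x).1, ?_⟩
  refine Integrable.of_bound (C := c) ?_ (Filter.Eventually.of_forall fun x => ?_)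
  · exact hH.norm.stronglyMeasurable.integral_prod_right.aestronglyMeasurable
  · rw [Real.norm_of_nonneg (integral_nonneg fun y => norm_nonneg _)]
    simp only [Real.norm_of_nonneg (hH0 _)]
    exact (h x).2

/-- The value of a sequence of random variables at an independent uniform index. -/
theorem integral_uniform_index {Ω : Type*} [MeasurableSpace Ω] {P : Measure Ω}
    [IsProbabilityMeasure P] {J : Ω → ℕ} (hJ : Measurable J) {T : ℕ} (hT : T ≠ 0)
    (hunif : ∀ t ∈ Finset.Icc 1 T, P {ω | J ω = t} = (T : ℝ≥0∞)⁻¹) {h : ℕ → Ω → ℝ}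
    (hh : ∀ t, Integrable (h t) P) (hind : ∀ t, IndepFun J (h t) P) :
    Integrable (fun ω => h (J ω) ω) P ∧
      ∫ ω, h (J ω) ω ∂P = (T : ℝ)⁻¹ * ∑ t ∈ Finset.Icc 1 T, ∫ ω, h t ω ∂P := by
  have hmeas : ∀ t, MeasurableSet {ω | J ω = t} := fun t => hJ (measurableSet_singleton t)
  -- The `T` disjoint events of mass `1/T` exhaust the probability, so values of `J` outside `{1, …,
  -- T}` are negligible.
  have hsupp : ∀ᵐ ω ∂P, J ω ∈ Finset.Icc 1 T := by
    have h1 : P (J ⁻¹' (Finset.Icc 1 T : Finset ℕ)) = 1 := by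
      have : J ⁻¹' (Finset.Icc 1 T : Finset ℕ) = ⋃ t ∈ Finset.Icc 1 T, {ω | J ω = t} := by
        ext ω; simp
      rw [this, measure_biUnion_finset (fun s _ t _ hst => by
        refine Set.disjoint_left.2 fun ω hs ht => hst ?_
        exact hs.symm.trans ht) fun t _ => hmeas t, Finset.sum_congr rfl hunif]
      simp only [Finset.sum_const, Nat.card_Icc, add_tsub_cancel_right, nsmul_eq_mul]
      exact ENNReal.mul_inv_cancel (by simpa using hT) (ENNReal.natCast_ne_top T)
    exact (prob_compl_eq_zero_iff (hJ (Finset.measurableSet _))).2 h1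
  set φ : ℕ → ℕ → ℝ := fun t j => if j = t then 1 else 0 with hφ
  have hφm : ∀ t, Measurable (φ t) := fun t => measurable_of_countable _
  have hφJ : ∀ t, (fun ω => φ t (J ω)) = {ω | J ω = t}.indicator 1 := by
    intro t; funext ω; simp [hφ, Set.indicator_apply]
  have hφi : ∀ t, Integrable (fun ω => φ t (J ω)) P := by
    intro t; rw [hφJ]; exact (integrable_const (1 : ℝ)).indicator (hmeas t)
  have hind' : ∀ t, IndepFun (fun ω => φ t (J ω)) (h t) P := fun t =>
    (hind t).comp (hφm t) measurable_id
  have hmul : ∀ t, Integrable (fun ω => φ t (J ω) * h t ω) P := fun t =>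
    (hind' t).integrable_mul (hφi t) (hh t)
  have hae : (fun ω => h (J ω) ω) =ᵐ[P] fun ω => ∑ t ∈ Finset.Icc 1 T, φ t (J ω) * h t ω := by
    filter_upwards [hsupp] with ω hω
    simp only [hφ, ite_mul, one_mul, zero_mul]
    rw [Finset.sum_ite_eq, if_pos hω]
  refine ⟨(integrable_finsetSum _ fun t _ => hmul t).congr hae.symm, ?_⟩
  rw [integral_congr_ae hae, integral_finsetSum _ fun t _ => hmul t, Finset.mul_sum]
  refine Finset.sum_congr rfl fun t ht => ?_
  rw [(hind' t).integral_fun_mul_eq_mul_integral (hφi t).aestronglyMeasurable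
    (hh t).aestronglyMeasurable, hφJ, integral_indicator_one (hmeas t), measureReal_def, hunif t ht]
  simp

end Independence

end LocalSGDA

/-! ### Integrability along square-integrable models. -/

namespace LocalSGDA

open scoped Gradient RealInnerProductSpace

variable {d₁ d₂ n : ℕ}

section Integrability

variable {Ω : Type*} [MeasurableSpace Ω] {P : Measure Ω}

theorem integrable_norm_sq {E : Type*} [NormedAddCommGroup E] {X : Ω → E} (hX : MemLp X 2 P) :
    Integrable (fun ω => ‖X ω‖ ^ 2) P :=
  (memLp_two_iff_integrable_sq_norm hX.1).1 hX

variable [IsProbabilityMeasure P]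

theorem continuous_of_norm_sub_le {E E' : Type*} [NormedAddCommGroup E] [NormedAddCommGroup E']
    {h : E → E'} {L : ℝ} (hL : ∀ z z', ‖h z - h z'‖ ≤ L * ‖z - z'‖) : Continuous h :=
  (LipschitzWith.of_dist_le' (K := L) fun z z' => by
    rw [dist_eq_norm, dist_eq_norm]; exact hL z z').continuous

theorem memLp_two_comp_of_norm_sub_le {E E' : Type*} [NormedAddCommGroup E]
    [NormedAddCommGroup E'] {h : E → E'} {L : ℝ} (hL : ∀ z z', ‖h z - h z'‖ ≤ L * ‖z - z'‖)
    {Z : Ω → E} (hZ : MemLp Z 2 P) : MemLp (fun ω => h (Z ω)) 2 P := by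
  have h1 : MemLp (fun ω => ‖h 0‖ + L * ‖Z ω‖) 2 P :=
    (memLp_const ‖h 0‖).add (hZ.norm.const_mul L)
  refine h1.mono' ((continuous_of_norm_sub_le hL).comp_aestronglyMeasurable hZ.1)
    (Filter.Eventually.of_forall fun ω => ?_)
  have h2 := hL (Z ω) 0
  rw [sub_zero] at h2
  linarith [norm_sub_norm_le (h (Z ω)) (h 0)]

theorem measurable_gradient {d : ℕ} (Φ : Vec d → ℝ) : Measurable (∇ Φ) := by
  unfold gradient; fun_prop

variable {F : Joint d₁ d₂ → ℝ} {L μ : ℝ} (hF : Differentiable ℝ F)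
  (hL : ∀ z z', ‖∇ F z - ∇ F z'‖ ≤ L * ‖z - z'‖)
include hF hL

theorem measurable_potential (hL0 : 0 < L) (hμ : 0 < μ) (hPL : PLInY μ F) :
    Measurable (potential F) := by
  have h1 := (differentiable_envelope hF hL hL0 hμ hPL).continuous.measurable
  have h2 : Measurable fun z : Joint d₁ d₂ => z.fst := (WithLp.continuous_fst _ _ _).measurable
  exact ((h1.comp h2).const_mul 2).sub hF.continuous.measurable

/-- `∇Φ` differs from `∇ₓF` by at most a multiple of `‖∇_y F‖`, so it inherits the linear growth of
`∇F`. -/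
theorem integrable_norm_gradient_envelope_sq (hμ : 0 < μ) (hμL : μ ≤ L) (hPL : PLInY μ F)
    {Z : Ω → Joint d₁ d₂} (hZ : MemLp Z 2 P) :
    Integrable (fun ω => ‖∇ (envelope F) (Z ω).fst‖ ^ 2) P := by
  have h1 := (integrable_norm_sq (memLp_two_comp_of_norm_sub_le hL hZ)).const_mul
    (6 * (L / μ) ^ 2 + 2)
  refine h1.mono' ?_ (Filter.Eventually.of_forall fun ω => ?_)
  · exact ((((measurable_gradient _).comp (WithLp.continuous_fst _ _ _).measurable).norm.pow_const
      2).comp_aemeasurable hZ.1.aemeasurable).aestronglyMeasurable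
  · rw [Real.norm_of_nonneg (sq_nonneg _)]
    have h2 := norm_gradient_envelope_sub_gradX_sq_le hF hL hμ hμL hPL (Z ω).fst (Z ω).snd
    rw [pair_fst_snd] at h2
    have h3 := norm_add_sq_le_of_pos (∇ (envelope F) (Z ω).fst - gradX F (Z ω))
      (gradX F (Z ω)) one_pos
    rw [sub_add_cancel] at h3
    have h4 : ‖∇ F (Z ω)‖ ^ 2 = ‖gradX F (Z ω)‖ ^ 2 + ‖gradY F (Z ω)‖ ^ 2 := norm_sq_eq _
    rw [h4]
    have h5 : 0 ≤ (L / μ) ^ 2 * ‖gradX F (Z ω)‖ ^ 2 := by positivity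
    have h6 : 0 ≤ ‖gradY F (Z ω)‖ ^ 2 := by positivity
    linarith

/-- The PL inequality bounds `Φ - F` by `‖∇F‖²/(2μ)`, so the potential grows at most quadratically.
-/
theorem integrable_potential (hL0 : 0 < L) (hμ : 0 < μ) (hPL : PLInY μ F)
    {Z : Ω → Joint d₁ d₂} (hZ : MemLp Z 2 P) :
    Integrable (fun ω => potential F (Z ω)) P := by
  have h1 := (integrable_norm_sq (memLp_two_comp_of_norm_sub_le hL hZ)).const_mul (1 / μ)
  have h2 : Integrable (fun ω => |F 0| + ‖∇ F 0‖ * ‖Z ω‖ + L / 2 * ‖Z ω‖ ^ 2) P :=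
    ((integrable_const _).add ((hZ.norm.integrable one_le_two).const_mul _)).add
      ((integrable_norm_sq hZ).const_mul _)
  refine (h1.add h2).mono' ?_ (Filter.Eventually.of_forall fun ω => ?_)
  · exact ((measurable_potential hF hL hL0 hμ hPL).comp_aemeasurable
      hZ.1.aemeasurable).aestronglyMeasurable
  · have h3 := (hPL (Z ω).fst).2 (Z ω).snd
    have h4 := hPL.le_envelope (Z ω).fst (Z ω).snd
    rw [pair_fst_snd] at h3 h4
    have h5 : ‖gradY F (Z ω)‖ ^ 2 ≤ ‖∇ F (Z ω)‖ ^ 2 := by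
      gcongr; exact norm_snd_le _
    have h6 : 2 * (envelope F (Z ω).fst - F (Z ω)) ≤ 1 / μ * ‖∇ F (Z ω)‖ ^ 2 := by
      rw [div_mul_eq_mul_div, one_mul, le_div_iff₀ hμ]; linarith
    have h7 := abs_le.1 (abs_sub_linearization_le hF hL 0 (Z ω))
    rw [zero_add] at h7
    have h8 := abs_le.1 (abs_real_inner_le_norm (∇ F 0) (Z ω))
    have h9 := abs_le.1 (le_refl |F 0|)
    rw [Pi.add_apply, Real.norm_eq_abs, potential, abs_le]
    constructor <;> linarith [h7.1, h7.2, h8.1, h8.2, h9.1, h9.2]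

end Integrability

/-! ### The random run: counters, measurability, independence, second moments. -/

section LocalRun

variable {Ξ : Fin n → Type*} {Ω : Type*}

/-- The local models after `t` iterations. -/
noncomputable def models (G : ∀ i, Joint d₁ d₂ → Ξ i → Joint d₁ d₂) (ηx ηy : ℝ) (τ : ℕ)
    (z₀ : Joint d₁ d₂) (ξ : ℕ → ∀ i, Ω → Ξ i) (t : ℕ) (ω : Ω) : Fin n → Joint d₁ d₂ :=
  (run G ηx ηy τ z₀ (fun t i => ξ t i ω) t).model

section Run

variable (G : ∀ i, Joint d₁ d₂ → Ξ i → Joint d₁ d₂) (ηx ηy : ℝ) (τ : ℕ) (z₀ : Joint d₁ d₂)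

theorem gradCount_run (ξ : ℕ → ∀ i, Ξ i) (t : ℕ) (i : Fin n) :
    (run G ηx ηy τ z₀ ξ t).gradCount i = t := by
  induction t with
  | zero => rfl
  | succ t ih =>
    rw [run, step]
    split_ifs <;> simp [ih]

theorem rounds_run (ξ : ℕ → ∀ i, Ξ i) (t : ℕ) :
    (run G ηx ηy τ z₀ ξ t).rounds = t / τ := by
  induction t with
  | zero => simp [run]
  | succ t ih =>
    rw [run, step, Nat.succ_div]
    simp only [Nat.dvd_iff_mod_eq_zero]
    split_ifs <;> simp [ih]

variable (ξ : ℕ → ∀ i, Ω → Ξ i) (t : ℕ)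

theorem models_succ_of_mod_eq (h : (t + 1) % τ = 0) (ω : Ω) :
    models G ηx ηy τ z₀ ξ (t + 1) ω =
      fun _ => mean (localStep G ηx ηy (models G ηx ηy τ z₀ ξ t ω) fun i => ξ t i ω) := by
  rw [models, run, step, if_pos h]; rfl

theorem models_succ_of_mod_ne (h : (t + 1) % τ ≠ 0) (ω : Ω) :
    models G ηx ηy τ z₀ ξ (t + 1) ω =
      localStep G ηx ηy (models G ηx ηy τ z₀ ξ t ω) fun i => ξ t i ω := by
  rw [models, run, step, if_neg h]; rfl

/-- Averaging does not move the average, so communication is invisible to the mean recursion. -/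
theorem mean_models_succ (hn : 1 ≤ n) (ω : Ω) :
    mean (models G ηx ηy τ z₀ ξ (t + 1) ω) =
      mean (localStep G ηx ηy (models G ηx ηy τ z₀ ξ t ω) fun i => ξ t i ω) := by
  by_cases h : (t + 1) % τ = 0
  · rw [models_succ_of_mod_eq _ _ _ _ _ _ _ h, mean_const hn]
  · rw [models_succ_of_mod_ne _ _ _ _ _ _ _ h]

theorem avgX_run (ξ : ℕ → ∀ i, Ξ i) :
    avgX (run G ηx ηy τ z₀ ξ t) = (mean (run G ηx ηy τ z₀ ξ t).model).fst :=
  (map_mean (WithLp.fstₗ 2 ℝ (Vec d₁) (Vec d₂)) _).symm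

end Run

theorem measurable_mean : Measurable (mean : (Fin n → Joint d₁ d₂) → Joint d₁ d₂) := by
  have h : ∀ i, Measurable fun z : Fin n → Joint d₁ d₂ => z i := fun i => measurable_pi_apply i
  exact (Finset.measurable_fun_sum _ fun i _ => h i).const_smul (n : ℝ)⁻¹

theorem measurable_spread : Measurable (spread : (Fin n → Joint d₁ d₂) → ℝ) := by
  have h : ∀ i, Measurable fun z : Fin n → Joint d₁ d₂ => z i := fun i => measurable_pi_apply i
  exact (Finset.measurable_fun_sum _ fun i _ =>
    ((h i).sub measurable_mean).norm.pow_const 2).const_smul (n : ℝ)⁻¹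

variable [∀ i, MeasurableSpace (Ξ i)]

theorem measurable_localStep {G : ∀ i, Joint d₁ d₂ → Ξ i → Joint d₁ d₂}
    (hG : ∀ i, Measurable fun p : Joint d₁ d₂ × Ξ i => G i p.1 p.2) (ηx ηy : ℝ) :
    Measurable fun p : (Fin n → Joint d₁ d₂) × (∀ i, Ξ i) => localStep G ηx ηy p.1 p.2 := by
  refine measurable_pi_iff.2 fun i => ?_
  simp only [localStep, descentAscent_eq]
  have h1 : Measurable fun p : (Fin n → Joint d₁ d₂) × (∀ i, Ξ i) => p.1 i :=
    (measurable_pi_apply i).comp measurable_fst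
  have h2 : Measurable fun p : (Fin n → Joint d₁ d₂) × (∀ i, Ξ i) => p.2 i :=
    (measurable_pi_apply i).comp measurable_snd
  exact h1.add ((displacement ηx ηy).continuous_of_finiteDimensional.measurable.comp
    ((hG i).comp (h1.prodMk h2)))

/-- The models after `t` iterations are a measurable function of the samples before `t`. -/
theorem measurable_models [MeasurableSpace Ω] {G : ∀ i, Joint d₁ d₂ → Ξ i → Joint d₁ d₂}
    (hG : ∀ i, Measurable fun p : Joint d₁ d₂ × Ξ i => G i p.1 p.2) (ηx ηy : ℝ) (τ : ℕ)
    (z₀ : Joint d₁ d₂) {ξ : ℕ → ∀ i, Ω → Ξ i} :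
    ∀ t : ℕ, (∀ s < t, ∀ i, Measurable (ξ s i)) → Measurable (models G ηx ηy τ z₀ ξ t) := by
  intro t
  induction t with
  | zero => exact fun _ => measurable_const
  | succ t ih =>
    intro hξ
    have h1 : Measurable fun ω => localStep G ηx ηy (models G ηx ηy τ z₀ ξ t ω) fun i => ξ t i ω :=
      (measurable_localStep hG ηx ηy).comp ((ih fun s hs => hξ s (hs.trans t.lt_succ_self)).prodMk
        (measurable_pi_iff.2 fun i => hξ t t.lt_succ_self i))
    by_cases h : (t + 1) % τ = 0
    · refine (funext fun ω => models_succ_of_mod_eq G ηx ηy τ z₀ ξ t h ω) ▸ ?_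
      exact measurable_pi_iff.2 fun _ => measurable_mean.comp h1
    · refine (funext fun ω => models_succ_of_mod_ne G ηx ηy τ z₀ ξ t h ω) ▸ ?_
      exact h1

variable [MeasurableSpace Ω] {P : Measure Ω} {𝒟 : ∀ i, Measure (Ξ i)}
  {ξ : ℕ → ∀ i, Ω → Ξ i} {T : ℕ} {J : Ω → ℕ}

theorem IsSampling.measurable_samples (hS : IsSampling P 𝒟 ξ T J) (t : ℕ) :
    Measurable fun ω i => ξ t i ω := measurable_pi_iff.2 fun i => hS.measurable_sample t i

theorem IsSampling.measurable_models (hS : IsSampling P 𝒟 ξ T J)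
    {G : ∀ i, Joint d₁ d₂ → Ξ i → Joint d₁ d₂}
    (hG : ∀ i, Measurable fun p : Joint d₁ d₂ × Ξ i => G i p.1 p.2) (ηx ηy : ℝ) (τ : ℕ)
    (z₀ : Joint d₁ d₂) (t : ℕ) : Measurable (models G ηx ηy τ z₀ ξ t) :=
  LocalSGDA.measurable_models hG ηx ηy τ z₀ t fun s _ i => hS.measurable_sample s i

theorem IsSampling.indepFun_models (hS : IsSampling P 𝒟 ξ T J)
    {G : ∀ i, Joint d₁ d₂ → Ξ i → Joint d₁ d₂}
    (hG : ∀ i, Measurable fun p : Joint d₁ d₂ × Ξ i => G i p.1 p.2) (ηx ηy : ℝ) (τ : ℕ)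
    (z₀ : Joint d₁ d₂) (t : ℕ) :
    IndepFun (models G ηx ηy τ z₀ ξ t) (fun ω i => ξ t i ω) P := by
  set m : ℕ × Fin n → MeasurableSpace Ω := fun p => MeasurableSpace.comap (ξ p.1 p.2) inferInstance
  have hm : ∀ p, m p ≤ ‹MeasurableSpace Ω› := fun p => (hS.measurable_sample p.1 p.2).comap_le
  have hdisj : Disjoint {p : ℕ × Fin n | p.1 < t} {p : ℕ × Fin n | p.1 = t} :=
    Set.disjoint_left.2 fun p hp hp' => by
      simp only [Set.mem_ofPred_eq] at hp hp'; omega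
  have h1 := indep_iSup_of_disjoint hm hS.indep_sample hdisj
  rw [IndepFun_iff_Indep]
  refine indep_of_indep_of_le_left (indep_of_indep_of_le_right h1 ?_) ?_
  · refine measurable_iff_comap_le.1 ?_
    refine (@measurable_pi_iff _ _ _ (_) _ _).2 fun i => measurable_iff_comap_le.2 ?_
    exact le_iSup₂_of_le (t, i) rfl le_rfl
  · refine measurable_iff_comap_le.1 ?_
    -- Measurability is applied with the σ-algebra generated by the samples before `t` in place of
    -- the ambient one, so the models at time `t` depend on the past only.
    refine @LocalSGDA.measurable_models _ _ _ _ _ _ (_) _ hG ηx ηy τ z₀ ξ t fun s hs i =>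
      measurable_iff_comap_le.2 ?_
    exact le_iSup₂_of_le (f := fun p (_ : p ∈ {p : ℕ × Fin n | p.1 < t}) => m p) (s, i) hs le_rfl

theorem IsSampling.indepFun_index_models (hS : IsSampling P 𝒟 ξ T J)
    {G : ∀ i, Joint d₁ d₂ → Ξ i → Joint d₁ d₂}
    (hG : ∀ i, Measurable fun p : Joint d₁ d₂ × Ξ i => G i p.1 p.2) (ηx ηy : ℝ) (τ : ℕ)
    (z₀ : Joint d₁ d₂) (t : ℕ) : IndepFun J (models G ηx ηy τ z₀ ξ t) P := by
  have h1 := hS.indep_index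
  rw [IndepFun_iff_Indep] at h1 ⊢
  refine indep_of_indep_of_le_right h1 (measurable_iff_comap_le.1 ?_)
  refine @LocalSGDA.measurable_models _ _ _ _ _ _ (_) _ hG ηx ηy τ z₀ ξ t fun s hs i => ?_
  have h2 : Measurable fun q : ∀ p : ℕ × Fin n, Ξ p.2 => q (s, i) := measurable_pi_apply (s, i)
  exact h2.comp (comap_measurable _)

theorem integrable_spread {Z : Ω → Fin n → Joint d₁ d₂} (hZ : ∀ i, MemLp (fun ω => Z ω i) 2 P) :
    Integrable (fun ω => spread (Z ω)) P :=
  integrable_mean fun i => integrable_norm_sq ((hZ i).sub (memLp_mean hZ))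

variable [IsProbabilityMeasure P]

theorem IsSampling.map_eq_pi (hS : IsSampling P 𝒟 ξ T J) (t : ℕ) :
    P.map (fun ω i => ξ t i ω) = Measure.pi 𝒟 := by
  have h1 := hS.indep_sample.precomp (g := fun i : Fin n => (t, i)) fun i j h => (Prod.ext_iff.1 h).2
  have h2 := (iIndepFun_iff_map_fun_eq_pi_map fun i => (hS.measurable_sample t i).aemeasurable).1 h1
  simp only [hS.law_sample] at h2
  exact h2

variable [∀ i, IsProbabilityMeasure (𝒟 i)] {σ L ηx ηy : ℝ} {f : Fin n → Joint d₁ d₂ → ℝ}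
  {G : ∀ i, Joint d₁ d₂ → Ξ i → Joint d₁ d₂}

/-- By induction: the noise has second moment at most `σ²` whatever the independent current models
are, and the gradients grow at most linearly. -/
theorem IsSampling.memLp_models (hS : IsSampling P 𝒟 ξ T J)
    (hG : UnbiasedBoundedVariance σ f 𝒟 G) (hf : Smooth L f) (hx : 0 ≤ ηx) (hxy : ηx ≤ ηy) (τ : ℕ)
    (z₀ : Joint d₁ d₂) (t : ℕ) : ∀ i, MemLp (fun ω => models G ηx ηy τ z₀ ξ t ω i) 2 P := by
  have hGm := fun i => (hG i).1
  induction t with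
  | zero => exact fun i => memLp_const z₀
  | succ t ih =>
    have hstep : ∀ i, MemLp (fun ω => localStep G ηx ηy (models G ηx ηy τ z₀ ξ t ω)
        (fun i => ξ t i ω) i) 2 P := by
      intro i
      have hgm : Measurable (∇ (f i)) := (continuous_of_norm_sub_le (hf i).2).measurable
      have hNm : Measurable fun p : (Fin n → Joint d₁ d₂) × (∀ i, Ξ i) => noise f G p.1 p.2 i := by
        have h1 : Measurable fun p : (Fin n → Joint d₁ d₂) × (∀ i, Ξ i) => p.1 i :=
          (measurable_pi_apply i).comp measurable_fst
        have h2 : Measurable fun p : (Fin n → Joint d₁ d₂) × (∀ i, Ξ i) => p.2 i :=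
          (measurable_pi_apply i).comp measurable_snd
        exact ((hGm i).comp (h1.prodMk h2)).sub (hgm.comp h1)
      have hXm := hS.measurable_models hGm ηx ηy τ z₀ t
      have hYm := hS.measurable_samples t
      have hN : MemLp (fun ω => noise f G (models G ηx ηy τ z₀ ξ t ω) (fun i => ξ t i ω) i) 2 P := by
        refine (memLp_two_iff_integrable_sq_norm
          (hNm.comp (hXm.prodMk hYm)).aestronglyMeasurable).2 ?_
        refine integrable_of_indepFun hXm hYm (hS.indepFun_models hGm ηx ηy τ z₀ t)
          (H := fun p => ‖noise f G p.1 p.2 i‖ ^ 2) (hNm.norm.pow_const 2)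
          (fun p => sq_nonneg _) (c := σ ^ 2) fun z => ?_
        rw [hS.map_eq_pi]
        exact ⟨hG.integrable_norm_noise_sq z i, hG.integral_norm_noise_sq_le z i⟩
      have hg : MemLp (fun ω => G i (models G ηx ηy τ z₀ ξ t ω i) (ξ t i ω)) 2 P := by
        have := hN.add (memLp_two_comp_of_norm_sub_le (hf i).2 (ih i))
        refine this.congr_norm ?_ (Filter.Eventually.of_forall fun ω => ?_)
        · exact ((hGm i).comp (((measurable_pi_apply i).comp hXm).prodMk
            (hS.measurable_sample t i))).aestronglyMeasurable
        · simp [noise]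
      have hd : MemLp (fun ω => displacement ηx ηy
          (G i (models G ηx ηy τ z₀ ξ t ω i) (ξ t i ω))) 2 P := by
        refine hg.of_le_mul (c := ηy) ?_ (Filter.Eventually.of_forall fun ω => ?_)
        · exact (displacement ηx ηy).continuous_of_finiteDimensional.comp_aestronglyMeasurable hg.1
        · refine le_of_sq_le_sq ?_ (mul_nonneg (hx.trans hxy) (norm_nonneg _))
          rw [mul_pow]
          exact norm_displacement_sq_le hx hxy _
      simp only [localStep, descentAscent_eq]
      exact (ih i).add hd
    intro i
    by_cases h : (t + 1) % τ = 0
    · simp only [models_succ_of_mod_eq G ηx ηy τ z₀ ξ t h]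
      exact memLp_mean hstep
    · simp only [models_succ_of_mod_ne G ηx ηy τ z₀ ξ t h]
      exact hstep i

end LocalRun

end LocalSGDA

/-! ### Drift recursion, telescoping and the random output. -/

namespace LocalSGDA

open scoped Gradient RealInnerProductSpace

/-- A quantity that is reset every `τ` steps and grows slowly in between stays small. -/
theorem le_of_reset_recursion {S : ℕ → ℝ} {τ : ℕ} (hτ : 1 ≤ τ) {c : ℝ} (hc : 0 ≤ c) (h0 : S 0 ≤ 0)
    (hreset : ∀ t, (t + 1) % τ = 0 → S (t + 1) ≤ 0)
    (hstep : ∀ t, (t + 1) % τ ≠ 0 → S (t + 1) ≤ (1 + 2 / (τ : ℝ)) * S t + c) (t : ℕ) :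
    S t ≤ 8 * τ * c := by
  have hτ0 : (0 : ℝ) < τ := by positivity
  set q : ℝ := 1 + 2 / (τ : ℝ) with hq
  have hq1 : 1 ≤ q := by
    have : 0 ≤ 2 / (τ : ℝ) := by positivity
    linarith
  -- `t % τ` counts the steps since the last reset; at most `τ` factors `q` compound, and `q ^ τ ≤
  -- e² < 8`.
  have hind : ∀ t, S t ≤ c * (t % τ : ℕ) * q ^ (t % τ) := by
    intro t
    induction t with
    | zero => simpa using h0
    | succ t ih =>
      by_cases h : (t + 1) % τ = 0
      · simpa [h] using hreset t h
      · have hmod : (t + 1) % τ = t % τ + 1 := by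
          rw [Nat.add_mod] at h ⊢
          rcases Nat.lt_or_ge (t % τ + 1 % τ) τ with hlt | hge
          · rw [Nat.mod_eq_of_lt hlt]
            rcases hτ.eq_or_lt with rfl | h1
            · omega
            · rw [Nat.mod_eq_of_lt h1]
          · exfalso
            have h1 : t % τ < τ := Nat.mod_lt _ hτ
            have h2 : 1 % τ ≤ 1 := Nat.mod_le _ _
            exact h (by rw [show t % τ + 1 % τ = τ by omega, Nat.mod_self])
        rw [hmod]
        refine (hstep t h).trans ?_
        have h1 : q * S t ≤ q * (c * (t % τ : ℕ) * q ^ (t % τ)) := by gcongr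
        have h2 : c * 1 ≤ c * q ^ (t % τ + 1) := by gcongr; exact one_le_pow₀ hq1
        push_cast
        rw [pow_succ] at h2 ⊢
        linarith
  have h1 : (t % τ : ℕ) ≤ τ := (Nat.mod_lt t hτ).le
  have h2 : q ^ (t % τ) ≤ 8 := by
    calc q ^ (t % τ) ≤ q ^ τ := pow_le_pow_right₀ hq1 h1
      _ ≤ Real.exp (2 / (τ : ℝ)) ^ τ := by
        gcongr
        rw [hq, add_comm]; exact Real.add_one_le_exp _
      _ = Real.exp 1 ^ 2 := by
        rw [← Real.exp_nat_mul, ← Real.exp_nat_mul]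
        congr 1; push_cast; field_simp
      _ ≤ 2.7182818286 ^ 2 := by gcongr; exact Real.exp_one_lt_d9.le
      _ ≤ 8 := by norm_num
  have h3 : ((t % τ : ℕ) : ℝ) ≤ τ := by exact_mod_cast h1
  calc S t ≤ c * (t % τ : ℕ) * q ^ (t % τ) := hind t
    _ ≤ c * τ * 8 := by gcongr
    _ = 8 * τ * c := by ring

variable {d₁ d₂ n : ℕ} {Ξ : Fin n → Type*} [∀ i, MeasurableSpace (Ξ i)] {Ω : Type*}
  [MeasurableSpace Ω] {P : Measure Ω} [IsProbabilityMeasure P] {𝒟 : ∀ i, Measure (Ξ i)}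
  [∀ i, IsProbabilityMeasure (𝒟 i)] {ξ : ℕ → ∀ i, Ω → Ξ i} {T : ℕ} {J : Ω → ℕ}
  {σ ςx ςy L μ κ ηx ηy : ℝ} {f : Fin n → Joint d₁ d₂ → ℝ}
  {G : ∀ i, Joint d₁ d₂ → Ξ i → Joint d₁ d₂} {τ : ℕ}

/-- The expected spread of the local models is `O(τ² ηy²)`. -/
theorem IsSampling.integral_spread_le (hS : IsSampling P 𝒟 ξ T J)
    (hG : UnbiasedBoundedVariance σ f 𝒟 G) (hf : Smooth L f)
    (hhet : BoundedHeterogeneity ςx ςy f) (hn : 1 ≤ n) (hL : 0 < L) (hx : 0 ≤ ηx)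
    (hxy : ηx ≤ ηy) (hτ : 1 ≤ τ) (hsmall : L * (τ * ηy) ≤ 1 / 8) (z₀ : Joint d₁ d₂) (t : ℕ) :
    ∫ ω, spread (models G ηx ηy τ z₀ ξ t ω) ∂P ≤
      48 * (τ * ηy) ^ 2 * (σ ^ 2 + ςx ^ 2 + ςy ^ 2) := by
  have hτ1 : (1 : ℝ) ≤ τ := by exact_mod_cast hτ
  have hτ0 : (0 : ℝ) < τ := by positivity
  have hy : 0 ≤ ηy := hx.trans hxy
  have hGm := fun i => (hG i).1
  have hmem := hS.memLp_models hG hf hx hxy τ z₀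
  have hsp : ∀ t, 0 ≤ ∫ ω, spread (models G ηx ηy τ z₀ ξ t ω) ∂P := fun t =>
    integral_nonneg fun ω => spread_nonneg _
  have key := le_of_reset_recursion (S := fun t => ∫ ω, spread (models G ηx ηy τ z₀ ξ t ω) ∂P) hτ
    (c := 3 * (1 + τ) * ηy ^ 2 * (σ ^ 2 + ςx ^ 2 + ςy ^ 2)) (by positivity) ?_ ?_ ?_ t
  · refine key.trans ?_
    calc 8 * τ * (3 * (1 + τ) * ηy ^ 2 * (σ ^ 2 + ςx ^ 2 + ςy ^ 2))
        ≤ 8 * τ * (3 * (τ + τ) * ηy ^ 2 * (σ ^ 2 + ςx ^ 2 + ςy ^ 2)) := by gcongr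
      _ = _ := by ring
  · simp only [models, run, spread_const hn, integral_zero, le_refl]
  · intro t h
    simp only [models_succ_of_mod_eq _ _ _ _ _ _ _ h, spread_const hn, integral_zero, le_refl]
  · intro t h
    have hi := integrable_spread (hmem t)
    have hi' := integrable_spread (hmem (t + 1))
    simp only [models_succ_of_mod_ne _ _ _ _ _ _ _ h] at hi' ⊢
    have h1 := integral_le_of_indepFun (hS.measurable_models hGm ηx ηy τ z₀ t)
      (hS.measurable_samples t) (hS.indepFun_models hGm ηx ηy τ z₀ t)
      (H := fun p => spread (localStep G ηx ηy p.1 p.2))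
      (measurable_spread.comp (measurable_localStep hGm ηx ηy)) hi'
      (B := fun z => (1 + 1 / (τ : ℝ) + 3 * (1 + τ) * ηy ^ 2 * L ^ 2) * spread z
        + 3 * (1 + τ) * ηy ^ 2 * (σ ^ 2 + ςx ^ 2 + ςy ^ 2))
      ((measurable_spread.const_mul _).add_const _) ((hi.const_mul _).add (integrable_const _))
      (fun z hz => by
        rw [hS.map_eq_pi] at hz ⊢
        exact hG.integral_spread_localStep_le hn hf hhet hx hxy hτ0 z hz)
    refine h1.trans ?_
    rw [integral_add (hi.const_mul _) (integrable_const _), integral_const_mul, integral_const,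
      probReal_univ, one_smul]
    have h2 : (L * (τ * ηy)) ^ 2 ≤ (1 / 8) ^ 2 := by gcongr
    -- The smallness of `L τ ηy` keeps the smoothness feedback below one more `1/τ`, giving the
    -- growth factor `1 + 2/τ`.
    have h3 : 3 * (1 + τ) * ηy ^ 2 * L ^ 2 ≤ 1 / (τ : ℝ) := by
      rw [le_div_iff₀ hτ0]
      calc 3 * (1 + τ) * ηy ^ 2 * L ^ 2 * τ ≤ 3 * (τ + τ) * ηy ^ 2 * L ^ 2 * τ := by gcongr
        _ = 6 * (L * (τ * ηy)) ^ 2 := by ring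
        _ ≤ 1 := by linarith
    have h4 : 2 / (τ : ℝ) = 1 / τ + 1 / τ := by ring
    have h5 : 1 + 1 / (τ : ℝ) + 3 * (1 + τ) * ηy ^ 2 * L ^ 2 ≤ 1 + 2 / (τ : ℝ) := by linarith
    exact add_le_add (mul_le_mul_of_nonneg_right h5 (hsp t)) le_rfl

/-- The expected decrease of the potential at the average model in one iteration. -/
theorem IsSampling.integral_potential_succ_le (hS : IsSampling P 𝒟 ξ T J)
    (hG : UnbiasedBoundedVariance σ f 𝒟 G) (hf : Smooth L f) (hn : 1 ≤ n) (hμ : 0 < μ)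
    (hμL : μ ≤ L) (hκ : κ = L / μ) (hPL : PLInY μ (globalLoss f)) (hηy : 0 < ηy)
    (hηx : ηx = ηy / (8 * κ ^ 2)) (hxy : ηx ≤ ηy) (hsmall : L * ηy ≤ 1 / 8) (τ : ℕ)
    (z₀ : Joint d₁ d₂) (t : ℕ) :
    ∫ ω, potential (globalLoss f) (mean (models G ηx ηy τ z₀ ξ (t + 1) ω)) ∂P ≤
      ∫ ω, potential (globalLoss f) (mean (models G ηx ηy τ z₀ ξ t ω)) ∂P
        - ηx / 2 * ∫ ω, ‖∇ (envelope (globalLoss f)) (mean (models G ηx ηy τ z₀ ξ t ω)).fst‖ ^ 2 ∂P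
        + 2 * ηy * L ^ 2 * ∫ ω, spread (models G ηx ηy τ z₀ ξ t ω) ∂P
        + L / 2 * ηy ^ 2 * (σ ^ 2 / n) := by
  have hL0 : 0 < L := hμ.trans_le hμL
  have hx : 0 ≤ ηx := by rw [hηx]; positivity
  have hF := hf.differentiable_globalLoss
  have hFL := hf.globalLoss_lipschitz hn hL0.le
  have hGm := fun i => (hG i).1
  have hmem := hS.memLp_models hG hf hx hxy τ z₀
  have hmean := fun t => memLp_mean (hmem t)
  have hi1 := integrable_potential hF hFL hL0 hμ hPL (hmean t)
  have hi1' := integrable_potential hF hFL hL0 hμ hPL (hmean (t + 1))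
  have hi2 := (integrable_norm_gradient_envelope_sq hF hFL hμ hμL hPL (hmean t)).const_mul (ηx / 2)
  have hi3 := (integrable_spread (hmem t)).const_mul (2 * ηy * L ^ 2)
  have hm1 : Measurable fun z : Fin n → Joint d₁ d₂ => potential (globalLoss f) (mean z) :=
    (measurable_potential hF hFL hL0 hμ hPL).comp measurable_mean
  have hfst : Measurable fun z : Fin n → Joint d₁ d₂ => (mean z).fst :=
    (WithLp.continuous_fst 2 (Vec d₁) (Vec d₂)).measurable.comp measurable_mean
  have hm2 : Measurable fun z : Fin n → Joint d₁ d₂ =>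
      ηx / 2 * ‖∇ (envelope (globalLoss f)) (mean z).fst‖ ^ 2 :=
    (((measurable_gradient _).comp hfst).norm.pow_const 2).const_mul _
  have hi1'' : Integrable (fun ω => potential (globalLoss f) (mean (localStep G ηx ηy
      (models G ηx ηy τ z₀ ξ t ω) fun i => ξ t i ω))) P := by
    simpa only [mean_models_succ G ηx ηy τ z₀ ξ t hn] using hi1'
  have h1 := integral_le_of_indepFun (hS.measurable_models hGm ηx ηy τ z₀ t)
    (hS.measurable_samples t) (hS.indepFun_models hGm ηx ηy τ z₀ t)
    (H := fun p => potential (globalLoss f) (mean (localStep G ηx ηy p.1 p.2)))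
    (hm1.comp (measurable_localStep hGm ηx ηy)) hi1''
    (B := fun z => potential (globalLoss f) (mean z)
      - ηx / 2 * ‖∇ (envelope (globalLoss f)) (mean z).fst‖ ^ 2
      + 2 * ηy * L ^ 2 * spread z + L / 2 * ηy ^ 2 * (σ ^ 2 / n))
    (((hm1.sub hm2).add (measurable_spread.const_mul _)).add_const _)
    (((hi1.sub hi2).add hi3).add (integrable_const _))
    (fun z hz => by
      rw [hS.map_eq_pi] at hz ⊢
      exact hG.integral_potential_localStep_le hn hf hμ hμL hκ hPL hηy hηx hsmall z hz)
  simp only [mean_models_succ G ηx ηy τ z₀ ξ t hn]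
  refine h1.trans_eq ?_
  have e1 := integral_add ((hi1.sub hi2).add hi3)
    (integrable_const (μ := P) (L / 2 * ηy ^ 2 * (σ ^ 2 / n)))
  have e2 := integral_add (hi1.sub hi2) hi3
  have e3 := integral_sub hi1 hi2
  refine e1.trans ?_
  rw [integral_const, probReal_univ, one_smul]
  congr 1
  refine e2.trans ?_
  rw [integral_const_mul]
  congr 1
  refine e3.trans ?_
  rw [integral_const_mul]

/-- The sum of the expected squared gradient norms along the average iterates. -/
theorem IsSampling.sum_integral_norm_gradient_sq_le (hS : IsSampling P 𝒟 ξ T J)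
    (hG : UnbiasedBoundedVariance σ f 𝒟 G) (hf : Smooth L f)
    (hhet : BoundedHeterogeneity ςx ςy f) (hn : 1 ≤ n) (hμ : 0 < μ)
    (hμL : μ ≤ L) (hκ : κ = L / μ) (hPL : PLInY μ (globalLoss f)) (hηy : 0 < ηy)
    (hηx : ηx = ηy / (8 * κ ^ 2)) (hτ : 1 ≤ τ) (hsmall : L * (τ * ηy) ≤ 1 / 8) {Δ D : ℝ}
    {x₀ : Vec d₁} {y₀ : Vec d₂}
    (hΔ : ∀ x, envelope (globalLoss f) x₀ - envelope (globalLoss f) x ≤ Δ)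
    (hD : envelope (globalLoss f) x₀ - globalLoss f (pair x₀ y₀) ≤ D) (N : ℕ) :
    ηx / 2 * ∑ t ∈ Finset.range N, ∫ ω, ‖∇ (envelope (globalLoss f))
        (mean (models G ηx ηy τ (pair x₀ y₀) ξ t ω)).fst‖ ^ 2 ∂P ≤
      Δ + D + N * (96 * ηy * L ^ 2 * (τ * ηy) ^ 2 * (σ ^ 2 + ςx ^ 2 + ςy ^ 2)
        + L / 2 * ηy ^ 2 * (σ ^ 2 / n)) := by
  have hL0 : 0 < L := hμ.trans_le hμL
  have hκ1 : 1 ≤ κ := by rw [hκ]; exact (one_le_div hμ).2 hμL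
  have hx : 0 ≤ ηx := by rw [hηx]; positivity
  have hxy : ηx ≤ ηy := by
    rw [hηx]
    exact div_le_self hηy.le (by nlinarith)
  have hτ1 : (1 : ℝ) ≤ τ := by exact_mod_cast hτ
  have hsmall' : L * ηy ≤ 1 / 8 := by
    refine le_trans ?_ hsmall
    gcongr
    exact le_mul_of_one_le_left hηy.le hτ1
  set A : ℕ → ℝ := fun t => ∫ ω, potential (globalLoss f)
    (mean (models G ηx ηy τ (pair x₀ y₀) ξ t ω)) ∂P with hA
  set g : ℕ → ℝ := fun t => ∫ ω, ‖∇ (envelope (globalLoss f))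
        (mean (models G ηx ηy τ (pair x₀ y₀) ξ t ω)).fst‖ ^ 2 ∂P with hg
  set c := 96 * ηy * L ^ 2 * (τ * ηy) ^ 2 * (σ ^ 2 + ςx ^ 2 + ςy ^ 2)
        + L / 2 * ηy ^ 2 * (σ ^ 2 / n) with hc
  have hstep : ∀ t, A (t + 1) ≤ A t - ηx / 2 * g t + c := by
    intro t
    have h1 := hS.integral_potential_succ_le hG hf hn hμ hμL hκ hPL hηy hηx hxy hsmall' τ
      (pair x₀ y₀) t
    have h2 := hS.integral_spread_le hG hf hhet hn hL0 hx hxy hτ hsmall (pair x₀ y₀) t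
    have h3 := mul_le_mul_of_nonneg_left h2 (by positivity : 0 ≤ 2 * ηy * L ^ 2)
    simp only [hA, hg, hc]
    linarith
  have hsum : ηx / 2 * ∑ t ∈ Finset.range N, g t ≤ A 0 - A N + N * c := by
    induction N with
    | zero => simp
    | succ N ih =>
      rw [Finset.sum_range_succ, mul_add]
      push_cast
      linarith [hstep N]
  have hA0 : A 0 = potential (globalLoss f) (pair x₀ y₀) := by
    simp only [hA, models, run, mean_const hn, integral_const, probReal_univ, one_smul]
  -- The potential dominates `Φ`, because `Φ - F ≥ 0`.
  have hAN : envelope (globalLoss f) x₀ - Δ ≤ A N := by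
    have h1 : ∀ ω, envelope (globalLoss f) x₀ - Δ ≤
        potential (globalLoss f) (mean (models G ηx ηy τ (pair x₀ y₀) ξ N ω)) := by
      intro ω
      set z := mean (models G ηx ηy τ (pair x₀ y₀) ξ N ω)
      have e1 := hΔ z.fst
      have e2 := hPL.le_envelope z.fst z.snd
      rw [pair_fst_snd] at e2
      rw [potential]
      linarith
    have h2 := integral_mono (μ := P) (integrable_const _)
      (integrable_potential hf.differentiable_globalLoss (hf.globalLoss_lipschitz hn hL0.le) hL0 hμ
        hPL (memLp_mean (hS.memLp_models hG hf hx hxy τ (pair x₀ y₀) N))) h1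
    rwa [integral_const, probReal_univ, one_smul] at h2
  rw [potential, pair_fst] at hA0
  refine hsum.trans ?_
  linarith

/-- The expected gradient norm at the output of Local SGDA. -/
theorem IsSampling.isAccurate_of_sum_le (hS : IsSampling P 𝒟 ξ T J) (hT : T ≠ 0)
    (hG : UnbiasedBoundedVariance σ f 𝒟 G) (hf : Smooth L f) (hn : 1 ≤ n) (hμ : 0 < μ)
    (hμL : μ ≤ L) (hPL : PLInY μ (globalLoss f)) (hx : 0 ≤ ηx) (hxy : ηx ≤ ηy)
    (z₀ : Joint d₁ d₂) {ε : ℝ} (hε : 0 < ε)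
    (h : ∑ t ∈ Finset.range (T + 1), ∫ ω, ‖∇ (envelope (globalLoss f))
        (mean (models G ηx ηy τ z₀ ξ t ω)).fst‖ ^ 2 ∂P ≤ T * ε ^ 2) :
    IsAccurate P (envelope (globalLoss f)) ε fun ω =>
      avgX (run G ηx ηy τ z₀ (fun t i => ξ t i ω) (J ω)) := by
  have hL0 : 0 < L := hμ.trans_le hμL
  have hT0 : (0 : ℝ) < T := by positivity
  have hGm := fun i => (hG i).1
  have hsq : ∀ t, Integrable (fun ω => ‖∇ (envelope (globalLoss f))
        (mean (models G ηx ηy τ z₀ ξ t ω)).fst‖ ^ 2) P := fun t =>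
    integrable_norm_gradient_envelope_sq hf.differentiable_globalLoss
      (hf.globalLoss_lipschitz hn hL0.le) hμ hμL hPL
      (memLp_mean (hS.memLp_models hG hf hx hxy τ z₀ t))
  have hfst : Measurable fun z : Fin n → Joint d₁ d₂ => (mean z).fst :=
    (WithLp.continuous_fst 2 (Vec d₁) (Vec d₂)).measurable.comp measurable_mean
  have hm : Measurable fun z : Fin n → Joint d₁ d₂ =>
      ‖∇ (envelope (globalLoss f)) (mean z).fst‖ := ((measurable_gradient _).comp hfst).norm
  -- Replaces Jensen's inequality: a mean square of at most `ε²` gives a mean of at most `ε`, and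
  -- integrability of the norm comes along.
  have hle : ∀ a : ℝ, a ≤ (2 * ε)⁻¹ * a ^ 2 + ε / 2 := by
    intro a
    have h1 : (2 * ε)⁻¹ * a ^ 2 + ε / 2 - a = (a - ε) ^ 2 / (2 * ε) := by field_simp; ring
    have h2 : 0 ≤ (a - ε) ^ 2 / (2 * ε) := by positivity
    linarith
  have hint : ∀ t, Integrable (fun ω => ‖∇ (envelope (globalLoss f))
        (mean (models G ηx ηy τ z₀ ξ t ω)).fst‖) P := fun t => by
    refine (((hsq t).const_mul (2 * ε)⁻¹).add (integrable_const (ε / 2))).mono'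
      (hm.comp (hS.measurable_models hGm ηx ηy τ z₀ t)).aestronglyMeasurable
      (Filter.Eventually.of_forall fun ω => ?_)
    rw [norm_norm]
    exact hle _
  have hmain := integral_uniform_index hS.measurable_index hT hS.uniform_index hint fun t =>
    (hS.indepFun_index_models hGm ηx ηy τ z₀ t).comp measurable_id hm
  have hbound : ∀ t, ∫ ω, ‖∇ (envelope (globalLoss f))
        (mean (models G ηx ηy τ z₀ ξ t ω)).fst‖ ∂P ≤ (2 * ε)⁻¹ * ∫ ω, ‖∇ (envelope (globalLoss f))
        (mean (models G ηx ηy τ z₀ ξ t ω)).fst‖ ^ 2 ∂P + ε / 2 := fun t => by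
    refine (integral_mono (hint t) (((hsq t).const_mul (2 * ε)⁻¹).add (integrable_const (ε / 2)))
      fun ω => hle _).trans_eq ?_
    rw [integral_add' ((hsq t).const_mul _) (integrable_const _), integral_const_mul,
      integral_const, probReal_univ, one_smul]
  simp only [IsAccurate, avgX_run]
  refine ⟨hmain.1, hmain.2.trans_le ?_⟩
  rw [inv_mul_le_iff₀ hT0]
  refine (Finset.sum_le_sum fun t _ => hbound t).trans ?_
  rw [Finset.sum_add_distrib, ← Finset.mul_sum, Finset.sum_const, Nat.card_Icc,
    add_tsub_cancel_right, nsmul_eq_mul]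
  -- The descent sum covers `0, …, T`, the output only `1, …, T`; the nonnegative term `t = 0` is
  -- dropped.
  have hsub : ∑ t ∈ Finset.Icc 1 T, ∫ ω, ‖∇ (envelope (globalLoss f))
      (mean (models G ηx ηy τ z₀ ξ t ω)).fst‖ ^ 2 ∂P ≤ T * ε ^ 2 := by
    refine le_trans (Finset.sum_le_sum_of_subset_of_nonneg ?_ fun t _ _ =>
      integral_nonneg fun ω => sq_nonneg _) h
    intro t ht
    rw [Finset.mem_Icc] at ht
    rw [Finset.mem_range]; omega
  calc _ ≤ (2 * ε)⁻¹ * (T * ε ^ 2) + T * (ε / 2) := by gcongr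
    _ = T * ε := by field_simp; ring

end LocalSGDA

/-! ### Arithmetic of the step sizes, in the variables `w = T^{1/4}` and `m = n^{1/4}`. -/

namespace LocalSGDA

theorem rpow_quarter_pow {x : ℝ} (hx : 0 ≤ x) : (x ^ (1 / 4 : ℝ)) ^ 4 = x := by
  rw [← Real.rpow_natCast, ← Real.rpow_mul hx]
  norm_num

theorem tauScale_eq (n T : ℕ) :
    tauScale n T = (T : ℝ) ^ (1 / 4 : ℝ) / ((n : ℝ) ^ (1 / 4 : ℝ)) ^ 3 := by
  rw [tauScale, ← Real.rpow_natCast, ← Real.rpow_mul (Nat.cast_nonneg n)]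
  norm_num

theorem stepY_eq {L : ℝ} (hL : 0 ≤ L) (n T : ℕ) :
    stepY L n T = ((n : ℝ) ^ (1 / 4 : ℝ)) ^ 2 / (√L * ((T : ℝ) ^ (1 / 4 : ℝ)) ^ 2) := by
  have h : (n : ℝ) / (L * T) =
      (((n : ℝ) ^ (1 / 4 : ℝ)) ^ 2 / (√L * ((T : ℝ) ^ (1 / 4 : ℝ)) ^ 2)) ^ 2 := by
    rw [div_pow, mul_pow, ← pow_mul, ← pow_mul, rpow_quarter_pow (Nat.cast_nonneg n),
      rpow_quarter_pow (Nat.cast_nonneg T), Real.sq_sqrt hL]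
  rw [stepY, h, Real.sqrt_sq (by positivity)]

/-- The constant in the bound `K κ² / √(n T)` on the mean squared gradient norm. -/
noncomputable def rateConst (L σ ςx ςy Δ D b : ℝ) : ℝ :=
  16 * ((Δ + D) * √L + 192 * L * b ^ 2 * (σ ^ 2 + ςx ^ 2 + ςy ^ 2) + √L * σ ^ 2)

/-- The choice of the step sizes in the sum of the one-step bounds. -/
theorem sum_le_of_rateConst_le {L σ ςx ςy Δ D b κ ηx ηy ε w m x s : ℝ} (hL : 0 < L) (hκ : 0 < κ)
    (hw : 1 ≤ w) (hm : 0 < m) (hx0 : 0 ≤ x) (hηy : ηy = m ^ 2 / (√L * w ^ 2))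
    (hηx : ηx = ηy / (8 * κ ^ 2)) (hx : x ≤ b / (√L * w * m))
    (hK : rateConst L σ ςx ςy Δ D b * κ ^ 2 ≤ ε ^ 2 * (w * m) ^ 2)
    (hs : ηx / 2 * s ≤ Δ + D + (w ^ 4 + 1) * (96 * ηy * L ^ 2 * x ^ 2 * (σ ^ 2 + ςx ^ 2 + ςy ^ 2)
        + L / 2 * ηy ^ 2 * (σ ^ 2 / m ^ 4))) : s ≤ w ^ 4 * ε ^ 2 := by
  have hw0 : 0 < w := one_pos.trans_le hw
  obtain ⟨l, hl, rfl⟩ : ∃ l : ℝ, 0 < l ∧ l ^ 2 = L := ⟨√L, Real.sqrt_pos.2 hL, Real.sq_sqrt hL.le⟩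
  rw [rateConst, Real.sqrt_sq hl.le] at hK
  rw [Real.sqrt_sq hl.le] at hηy hx
  set S := σ ^ 2 + ςx ^ 2 + ςy ^ 2 with hS
  have hS0 : 0 ≤ S := by positivity
  have hη0 : 0 < ηy := by rw [hηy]; positivity
  -- With `x = τ ηy`, this is `1/√(nT)`, the common order of the initial gap, the drift and the
  -- noise after division by `ηy T`.
  set ρ := ((w * m) ^ 2)⁻¹ with hρ
  have hρ0 : 0 < ρ := by positivity
  have a1 : Δ + D = ηy * w ^ 4 * ((Δ + D) * l * ρ) := by rw [hηy, hρ]; field_simp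
  have a3 : (l ^ 2) ^ 2 * x ^ 2 ≤ l ^ 2 * b ^ 2 * ρ := by
    calc (l ^ 2) ^ 2 * x ^ 2 ≤ (l ^ 2) ^ 2 * (b / (l * w * m)) ^ 2 := by gcongr
      _ = _ := by rw [hρ]; field_simp
  have a4 : l ^ 2 / 2 * ηy ^ 2 * (σ ^ 2 / m ^ 4) = ηy * (l * ρ * σ ^ 2 / 2) := by
    rw [sq ηy, hρ]; nth_rw 2 [hηy]; field_simp
  have a2 : w ^ 4 + 1 ≤ 2 * w ^ 4 := by linarith [one_le_pow₀ hw (n := 4)]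
  have a5 : ηx / 2 * s ≤ ηy * w ^ 4 * (ρ * ((Δ + D) * l + 192 * l ^ 2 * b ^ 2 * S + l * σ ^ 2)) := by
    calc ηx / 2 * s ≤ _ := hs
      _ ≤ Δ + D + 2 * w ^ 4 * (96 * ηy * (l ^ 2 * b ^ 2 * ρ) * S + ηy * (l * ρ * σ ^ 2 / 2)) := by
        rw [a4, mul_assoc (96 * ηy)]
        gcongr
      _ = ηy * w ^ 4 * ((Δ + D) * l * ρ) + 2 * w ^ 4 *
          (96 * ηy * (l ^ 2 * b ^ 2 * ρ) * S + ηy * (l * ρ * σ ^ 2 / 2)) := by rw [← a1]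
      _ = _ := by ring
  have a6 : ηx / 2 * s = ηy * s / (16 * κ ^ 2) := by rw [hηx]; field_simp; ring
  rw [a6, div_le_iff₀ (by positivity)] at a5
  have a7 : ρ * (16 * ((Δ + D) * l + 192 * l ^ 2 * b ^ 2 * S + l * σ ^ 2) * κ ^ 2) ≤ ε ^ 2 := by
    rw [hρ, inv_mul_le_iff₀ (by positivity)]; linarith
  refine le_of_mul_le_mul_left ?_ hη0
  calc ηy * s ≤ _ := a5
    _ = ηy * w ^ 4 * (ρ * (16 * ((Δ + D) * l + 192 * l ^ 2 * b ^ 2 * S + l * σ ^ 2) * κ ^ 2)) := by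
      ring
    _ ≤ ηy * w ^ 4 * ε ^ 2 := by gcongr
    _ = _ := by ring

/-- The number of iterations and of communication rounds for accuracy `ε`. -/
theorem ceil_le_and_rounds_le {C a κ ε w m : ℝ} {T n τ : ℕ} (hC : 0 < C) (ha : 0 < a) (hκ : 0 < κ)
    (hε : 0 < ε) (hw : 0 < w) (hm : 0 < m) (hwT : w ^ 4 = T) (hmn : m ^ 4 = n) (hT : 2 ≤ T)
    (hn : 1 ≤ n) (hτ : 1 ≤ τ) (haτ : a * (w / m ^ 3) ≤ τ) (hTC : T = ⌈C * κ ^ 4 / (n * ε ^ 4)⌉₊) :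
    (T : ℝ) ≤ 2 * C * κ ^ 4 / (n * ε ^ 4) ∧
      (T : ℝ) / τ + 1 ≤ (((2 * C) ^ (1 / 4 : ℝ)) ^ 3 / a + ((2 * C) ^ (1 / 4 : ℝ)) ^ 3) * κ ^ 3
        / ε ^ 3 := by
  have hn0 : (0 : ℝ) < n := by positivity
  have hτ0 : (0 : ℝ) < τ := by positivity
  set x := C * κ ^ 4 / (n * ε ^ 4) with hx
  have hx0 : 0 < x := by positivity
  -- `T ≥ 2` forces the number under the ceiling above `1`, so rounding up at most doubles it.
  have hx1 : 1 < x := by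
    by_contra! h
    have : T ≤ 1 := by rw [hTC]; exact Nat.ceil_le.2 (by simpa using h)
    omega
  have h1 : (T : ℝ) ≤ 2 * x := by
    have := Nat.ceil_lt_add_one hx0.le
    rw [← hTC] at this
    linarith
  have h2 : 2 * x = 2 * C * κ ^ 4 / (n * ε ^ 4) := by rw [hx]; ring
  refine ⟨h1.trans_eq h2, ?_⟩
  set q := (2 * C) ^ (1 / 4 : ℝ) with hq
  have hq0 : 0 < q := by positivity
  have hq4 : q ^ 4 = 2 * C := rpow_quarter_pow (by positivity)
  have h3 : w * m ≤ q * κ / ε := by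
    refine le_of_pow_le_pow_left₀ four_ne_zero (by positivity) ?_
    rw [mul_pow, hwT, hmn, div_pow, mul_pow, hq4]
    calc (T : ℝ) * n ≤ 2 * x * n := by gcongr
      _ = _ := by rw [hx]; field_simp
  -- Lets the `+ 1` that covers rounding up `T/τ` be absorbed into `(w m)³`.
  have h4 : 1 ≤ w * m := by
    refine le_of_pow_le_pow_left₀ four_ne_zero (by positivity) ?_
    rw [mul_pow, hwT, hmn, one_pow]
    have e1 : (1 : ℝ) ≤ T := by exact_mod_cast (one_le_two.trans hT)
    have e2 : (1 : ℝ) ≤ n := by exact_mod_cast hn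
    nlinarith
  have h5 : (T : ℝ) / τ ≤ (w * m) ^ 3 / a := by
    rw [div_le_div_iff₀ hτ0 ha]
    calc (T : ℝ) * a = (w * m) ^ 3 * (a * (w / m ^ 3)) := by rw [← hwT]; field_simp
      _ ≤ _ := by gcongr
  have h6 : (w * m) ^ 3 ≤ (q * κ / ε) ^ 3 := by gcongr
  calc (T : ℝ) / τ + 1 ≤ (q * κ / ε) ^ 3 / a + (q * κ / ε) ^ 3 := by
        refine add_le_add (h5.trans (by gcongr)) ((one_le_pow₀ h4).trans h6)
    _ = _ := by rw [div_pow, mul_pow]; field_simp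

end LocalSGDA

/-! ### Choice of the constants and assembly. -/

theorem mainTheorem2 :
    -- the constants may depend only on these parameters
    ∀ L σ ςx ςy Δ D a b : ℝ, 0 < L → 0 ≤ σ → 0 ≤ ςx → 0 ≤ ςy → 0 ≤ Δ → 0 ≤ D → 0 < a → a ≤ b →
    ∃ C₀ C₁ C₂ C₃ : ℝ, 0 < C₀ ∧ 0 < C₁ ∧ 0 < C₂ ∧ 0 < C₃ ∧
    -- the minimax problem and its stochastic gradient oracle
    ∀ (d₁ d₂ n : ℕ) (_ : 1 ≤ n) (f : Fin n → LocalSGDA.Joint d₁ d₂ → ℝ)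
      (Ξ : Fin n → Type*) [∀ i, MeasurableSpace (Ξ i)]
      (𝒟 : ∀ i, Measure (Ξ i)) [∀ i, IsProbabilityMeasure (𝒟 i)]
      (G : ∀ i, LocalSGDA.Joint d₁ d₂ → Ξ i → LocalSGDA.Joint d₁ d₂)
      (μ κ : ℝ) (x₀ : LocalSGDA.Vec d₁) (y₀ : LocalSGDA.Vec d₂),
      0 < μ → μ ≤ L → κ = L / μ →
      LocalSGDA.Smooth L f →
      LocalSGDA.UnbiasedBoundedVariance σ f 𝒟 G →
      LocalSGDA.BoundedHeterogeneity ςx ςy f →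
      (LocalSGDA.PLInY μ (LocalSGDA.globalLoss f) ∨
        LocalSGDA.StronglyConcaveInY μ (LocalSGDA.globalLoss f)) →
      (∀ x, LocalSGDA.envelope (LocalSGDA.globalLoss f) x₀ -
        LocalSGDA.envelope (LocalSGDA.globalLoss f) x ≤ Δ) →
      LocalSGDA.envelope (LocalSGDA.globalLoss f) x₀ -
        LocalSGDA.globalLoss f (LocalSGDA.pair x₀ y₀) ≤ D →
      Differentiable ℝ (LocalSGDA.envelope (LocalSGDA.globalLoss f)) ∧
      -- a run with `T ≥ C₀ n³` iterations and `τ ∼ T^{1/4} / n^{3/4}` local updates per round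
      ∀ (ε : ℝ) (T τ : ℕ), 0 < ε → C₀ * (n : ℝ) ^ 3 ≤ T → 1 ≤ τ →
        a * LocalSGDA.tauScale n T ≤ τ → (τ : ℝ) ≤ b * LocalSGDA.tauScale n T →
        LocalSGDA.stepY L n T ≤ 1 / (8 * L * τ) ∧
        ∀ (Ω : Type*) [MeasurableSpace Ω] (P : Measure Ω) [IsProbabilityMeasure P]
          (ξ : ℕ → ∀ i, Ω → Ξ i) (J : Ω → ℕ), LocalSGDA.IsSampling P 𝒟 ξ T J →
          -- accuracy, as soon as `T ≥ C₁ κ⁴ / (n ε⁴)`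
          (C₁ * κ ^ 4 / (n * ε ^ 4) ≤ T →
            LocalSGDA.IsAccurate P (LocalSGDA.envelope (LocalSGDA.globalLoss f)) ε fun ω =>
              LocalSGDA.avgX (LocalSGDA.run G (LocalSGDA.stepX L κ n T) (LocalSGDA.stepY L n T) τ
                (LocalSGDA.pair x₀ y₀) (fun t i => ξ t i ω) (J ω))) ∧
          -- cost of the run with this number of iterations
          (T = ⌈C₁ * κ ^ 4 / (n * ε ^ 4)⌉₊ →
            ∀ ω, (∀ i, (((LocalSGDA.run G (LocalSGDA.stepX L κ n T) (LocalSGDA.stepY L n T) τ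
                (LocalSGDA.pair x₀ y₀) (fun t i => ξ t i ω) T).gradCount i : ℕ) : ℝ)
                  ≤ C₂ * κ ^ 4 / (n * ε ^ 4)) ∧
              (((LocalSGDA.run G (LocalSGDA.stepX L κ n T) (LocalSGDA.stepY L n T) τ
                (LocalSGDA.pair x₀ y₀) (fun t i => ξ t i ω) T).rounds : ℕ) : ℝ)
                  ≤ C₃ * κ ^ 3 / ε ^ 3 ∧
              (⌈(T : ℝ) / τ⌉₊ : ℝ) ≤ C₃ * κ ^ 3 / ε ^ 3) := by

  intro L σ ςx ςy Δ D a b hL hσ hςx hςy hΔ0 hD0 ha hab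
  have hb : 0 < b := ha.trans_le hab
  set K := LocalSGDA.rateConst L σ ςx ςy Δ D b with hK
  have hK0 : 0 ≤ K := by rw [hK, LocalSGDA.rateConst]; positivity
  -- Accuracy requires `K κ² ≤ ε² √(nT)`, that is `K² κ⁴ ≤ nT ε⁴`; the `+ 1` keeps the constant
  -- positive when `K = 0`.
  set C := K ^ 2 + 1 with hC
  have hC0 : 0 < C := by positivity
  -- In `C₀`, the `2` ensures `T ≥ 2` for the ceiling estimate, and the square ensures `8 √L b ≤
  -- T^{1/4}`, hence `L τ ηy ≤ 1/8`.
  refine ⟨2 + (64 * L * b ^ 2) ^ 2, C, 2 * C,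
    ((2 * C) ^ (1 / 4 : ℝ)) ^ 3 / a + ((2 * C) ^ (1 / 4 : ℝ)) ^ 3, by positivity, hC0,
    by positivity, by positivity, ?_⟩
  intro d₁ d₂ n hn f Ξ _ 𝒟 _ G μ κ x₀ y₀ hμ hμL hκ hf hG hhet hcond hΔ hD
  have hκ1 : 1 ≤ κ := by rw [hκ]; exact (one_le_div hμ).2 hμL
  have hκ0 : 0 < κ := one_pos.trans_le hκ1
  have hF := hf.differentiable_globalLoss
  have hPL : LocalSGDA.PLInY μ (LocalSGDA.globalLoss f) := hcond.elim id fun h => h.plInY hF hμ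
  refine ⟨LocalSGDA.differentiable_envelope hF (hf.globalLoss_lipschitz hn hL.le) hL hμ hPL, ?_⟩
  intro ε T τ hε hT hτ haτ hbτ
  have hn1 : (1 : ℝ) ≤ n := by exact_mod_cast hn
  have hTC : 2 + (64 * L * b ^ 2) ^ 2 ≤ (T : ℝ) :=
    (le_mul_of_one_le_right (by positivity) (one_le_pow₀ hn1)).trans hT
  have hT2 : 2 ≤ T := by
    have : (2 : ℝ) ≤ T := by linarith [sq_nonneg (64 * L * b ^ 2)]
    exact_mod_cast this
  set w := (T : ℝ) ^ (1 / 4 : ℝ) with hw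
  set m := (n : ℝ) ^ (1 / 4 : ℝ) with hm
  have hT0 : (0 : ℝ) < T := by positivity
  have hn0 : (0 : ℝ) < n := by positivity
  have hτ0 : (0 : ℝ) < τ := by positivity
  have hw1 : 1 ≤ w := Real.one_le_rpow (by exact_mod_cast one_le_two.trans hT2) (by norm_num)
  have hm1 : 1 ≤ m := Real.one_le_rpow hn1 (by norm_num)
  have hw0 : 0 < w := one_pos.trans_le hw1
  have hm0 : 0 < m := one_pos.trans_le hm1
  have hwT : w ^ 4 = T := LocalSGDA.rpow_quarter_pow hT0.le
  have hmn : m ^ 4 = n := LocalSGDA.rpow_quarter_pow hn0.le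
  have hηy : LocalSGDA.stepY L n T = m ^ 2 / (√L * w ^ 2) := LocalSGDA.stepY_eq hL.le n T
  have hl : 0 < √L := Real.sqrt_pos.2 hL
  have hηx : LocalSGDA.stepX L κ n T = LocalSGDA.stepY L n T / (8 * κ ^ 2) := by
    rw [LocalSGDA.stepX, LocalSGDA.stepY]; ring
  set ηy := LocalSGDA.stepY L n T with hηy'
  set ηx := LocalSGDA.stepX L κ n T with hηx'
  have hηy0 : 0 < ηy := by rw [hηy]; positivity
  have hηx0 : 0 ≤ ηx := by rw [hηx]; positivity
  have hxy : ηx ≤ ηy := by rw [hηx]; exact div_le_self hηy0.le (by nlinarith)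
  rw [LocalSGDA.tauScale_eq] at haτ hbτ
  have hτη : τ * ηy ≤ b / (√L * w * m) := by
    calc τ * ηy ≤ b * (w / m ^ 3) * ηy := by gcongr
      _ = b / (√L * w * m) := by rw [hηy]; field_simp
  have hsmall : L * (τ * ηy) ≤ 1 / 8 := by
    have h1 : 64 * L * b ^ 2 ≤ w ^ 2 := by
      refine le_of_sq_le_sq ?_ (by positivity)
      rw [← pow_mul, hwT]; linarith
    have h2 : 8 * √L * b ≤ w := by
      refine le_of_sq_le_sq ?_ hw0.le
      rw [mul_pow, mul_pow, Real.sq_sqrt hL.le]; linarith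
    calc L * (τ * ηy) ≤ L * (b / (√L * w * m)) := by gcongr
      _ = √L * b / (w * m) := by
        nth_rw 1 [← Real.mul_self_sqrt hL.le]; field_simp
      _ ≤ 1 / 8 := by
        rw [div_le_div_iff₀ (by positivity) (by norm_num)]
        nlinarith [mul_le_mul h2 hm1 zero_le_one hw0.le]
  refine ⟨?_, ?_⟩
  · rw [le_div_iff₀ (by positivity)]; linarith
  intro Ω _ P _ ξ J hS
  refine ⟨fun hacc => ?_, fun hTeq ω => ?_⟩
  · refine hS.isAccurate_of_sum_le (by positivity) hG hf hn hμ hμL hPL hηx0 hxy _ hε ?_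
    have hsum := hS.sum_integral_norm_gradient_sq_le hG hf hhet hn hμ hμL hκ hPL hηy0 hηx hτ
      hsmall hΔ hD (T + 1)
    push_cast at hsum
    rw [← hwT, ← hmn] at hsum
    rw [← hwT]
    refine LocalSGDA.sum_le_of_rateConst_le (L := L) (σ := σ) (ςx := ςx) (ςy := ςy) (Δ := Δ)
      (D := D) hL hκ0 hw1 hm0 (by positivity) hηy hηx hτη ?_ hsum
    refine le_of_sq_le_sq ?_ (by positivity)
    rw [div_le_iff₀ (by positivity), ← hwT, ← hmn] at hacc
    calc (K * κ ^ 2) ^ 2 = K ^ 2 * κ ^ 4 := by ring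
      _ ≤ C * κ ^ 4 := by gcongr; rw [hC]; linarith
      _ ≤ w ^ 4 * (m ^ 4 * ε ^ 4) := hacc
      _ = _ := by ring
  · obtain ⟨h1, h2⟩ := LocalSGDA.ceil_le_and_rounds_le hC0 ha hκ0 hε hw0 hm0 hwT hmn hT2 hn hτ haτ
      hTeq
    refine ⟨fun i => ?_, ?_, ?_⟩
    · rw [LocalSGDA.gradCount_run]; exact h1
    · rw [LocalSGDA.rounds_run]
      exact (Nat.cast_div_le.trans (by linarith)).trans h2
    · exact (Nat.ceil_lt_add_one (by positivity)).le.trans h2
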